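/- **Model.** In the massively parallel computation (MPC) model there are $\mathcal M$ machines, each with a local memory of $S$ words of $O(\log n)$ bits, working in synchronous rounds. In each round every machine performs an arbitrary (possibly randomized, with private randomness) local computation on the content of its memory and then sends messages to the machines; the words sent by a machine in a round, and the words held by a machine at any time (including those it receives), number at most $S$, for every outcome of the random choices. The input, an $m$-edge graph on the vertex set $\{0,\dots,n-1\}$ given as a list of edges (two words per edge), is initially distributed over the machines in an arbitrary way subject to the memory bound, and the total memory suffices to hold it. The algorithm may depend on $n,m,S,\varepsilon$, but not on the graph or on how its edges are distributed. The total space is $\mathcal M\cdot S$. **Theorem.** There are universal constants $R,a,b\in\mathbb N$ such that for every $c\in\mathbb N$ there is a constant $C>0$ (depending only on $c$), and for every $\varepsilon\in(0,1]$ a constant $D>0$ (depending only on $c$ and $\varepsilon$), with the following property. Let $n\ge 2$, $m\ge 1$ and $S\le 2m$ (the space per machine is at most the size of the input) be integers with $$S\ \ge\ C(\log n)^a\cdot\max\left\{\frac{\sqrt m}{\varepsilon},\ \frac{n^2}{m}\right\}.$$ Then there is an MPC algorithm that uses $\mathcal M$ machines, each with a local space of $S$ words with values below $n^b$, and total space $$\mathcal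 M\cdot S\ \le\ D(\log n)^a\, m ,$$ runs for at most $R=O(1)$ rounds, and, for every graph $G$ with $n$ vertices, $m$ edges and $T$ triangles such that $$T\ \ge\ C(\log n)^a\sqrt{\frac mS},$$ outputs a number $Y$ with $|Y-T|\le\varepsilon T$ with probability at least $1-n^{-c}$. (On every graph with $n$ vertices and $m$ edges, whatever $T$ is, the algorithm stays within its space bounds.) -/

import Mathlib

open scoped BigOperators

/-- The content of the local memory of one machine, in a system of `M` machines: the words
received at the end of the previous round, listed by sender. A machine keeps data from one round
to the next by sending it to itself. -/
abbrev MPCMemory (M : ℕ) : Type := Fin M → List ℕ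

/-- A randomized algorithm in the massively parallel computation model on `M` machines.

In round `r`, machine `j` applies the arbitrary function `step r j` to the content of its own
memory and to a fresh private random seed, which is uniform on `Fin seeds`; the value at `i` of the
result is the message (a list of words) that `j` sends to machine `i`. After the last round, the
machine `outMachine` computes the output from the content of its memory. -/
structure MPCAlgorithm (M : ℕ) where
  rounds : ℕ
  seeds : ℕ
  seeds_pos : 0 < seeds
  step : Fin rounds → Fin M → MPCMemory M → Fin seeds → (Fin M → List ℕ)
  outMachine : Fin M
  output : MPCMemory M → ℝ

namespace MPCAlgorithm

variable {M : ℕ}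

/-- The outcomes of all random choices: one seed for each round and each machine. -/
abbrev Tape (A : MPCAlgorithm M) : Type := Fin A.rounds → Fin M → Fin A.seeds

/-- `A.memory x ω t i j` is the list of words that, after `t` rounds, machine `i` holds in its
memory and received from machine `j`, when the initial contents of the memories are given by `x`
and the random choices by `ω`. -/
def memory (A : MPCAlgorithm M) (x : Fin M → MPCMemory M) (ω : A.Tape) :
    Fin (A.rounds + 1) → Fin M → MPCMemory M :=
  Fin.induction (motive := fun _ => Fin M → MPCMemory M) x
    (fun r mem i j => A.step r j (mem j) (ω r j) i)

/-- On the initial memories `x`, whatever the random choices are: at every time every machine holds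
at most `S` words in total, each of them a number below `W`, and in every round every machine sends
messages of at most `S` words in total. What a machine holds at a time `r + 1` is what it received
in round `r`, so the messages received by a machine in a round also have at most `S` words. -/
def RespectsSpace (A : MPCAlgorithm M) (S W : ℕ) (x : Fin M → MPCMemory M) : Prop :=
  ∀ ω : A.Tape,
    (∀ t i, ∑ j, (A.memory x ω t i j).length ≤ S ∧ ∀ j, ∀ w ∈ A.memory x ω t i j, w < W) ∧
    (∀ (r : Fin A.rounds) (j : Fin M), ∑ i, (A.memory x ω r.succ i j).length ≤ S)

/-- The output of the algorithm. -/
def result (A : MPCAlgorithm M) (x : Fin M → MPCMemory M) (ω : A.Tape) : ℝ :=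
  A.output (A.memory x ω (Fin.last A.rounds) A.outMachine)

/-- The probability, over independent uniform seeds, that the output has the property `P`. -/
noncomputable def outputProb (A : MPCAlgorithm M) (x : Fin M → MPCMemory M) (P : ℝ → Prop) : ℝ :=
  (Nat.card {ω : A.Tape // P (A.result x ω)} : ℝ) / (Nat.card A.Tape : ℝ)

end MPCAlgorithm

/-- `e` is a distribution of the edges of `G` over `M` machines of `S` words each: machine `i` gets
the list `e i` of edges, written as pairs of end points (two words per edge), and every edge of `G`
occurs exactly once altogether. The placement, the order and the orientations are arbitrary. -/
def IsEdgeDistribution {n M : ℕ} (G : SimpleGraph (Fin n)) [DecidableRel G.Adj] (S : ℕ)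
    (e : Fin M → List (Fin n × Fin n)) : Prop :=
  (∑ i, (((e i).map fun p => s(p.1, p.2) : List (Sym2 (Fin n))) : Multiset (Sym2 (Fin n)))) =
      G.edgeFinset.val ∧
    ∀ i, 2 * (e i).length ≤ S

/-- The initial memories: machine `i` holds the end points of its edges, one word each. -/
def edgeInput {n M : ℕ} (e : Fin M → List (Fin n × Fin n)) : Fin M → MPCMemory M :=
  fun i j => if j = i then (e i).flatMap (fun p => [(p.1 : ℕ), (p.2 : ℕ)]) else []

/-! A random vertex set that contains each vertex with probability `1 / Q` contains a triangle with
probability `Q⁻³`, so `Q³` times the number of triangles inside it is an unbiased estimate of `T`.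
For `Q` of order `√(m / S)` such a set induces about `m / Q²` edges, a small fraction of `S`, and
one machine can count its triangles locally. Two distinct triangles have at least four vertices
together, so the relative variance is at most `Q³ / T + Q²`. When `T ≥ Q`, averaging over `L` of
order `Q² / ε²` machines gives error `ε T / 4` with constant probability
(`uniformProb_not_abs_average_sub_le`). With `2 * g` batches of `L` machines, `g` of order `log n`,
a value close to most batch averages is correct except with probability `2⁻ᵍ`. The total space is
then of order `g * L * S`, that is, `g * m / ε²`.

It remains to bring the induced edges to their machines. A moment bound limits the number of edges
induced by each set (`uniformProb_lt_card_inducedEdges_le`). Edges are first moved to random relay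
machines by a hash function, so by a Chernoff bound no pair of machines exchanges many of them.
Messages are truncated at that bound, so the space limits hold for all random choices.

Fully random sets and a fully random hash function are too long to broadcast. By the probabilistic
method there is a fixed family of `n ^ (c + 5)` choices of which fewer than `n ^ 5` are bad for any
relevant input (`exists_choices`); an index into it takes `c + 5` words. -/

open scoped BigOperators

/-! ### Finite uniform probability: union bound, independence, Chernoff bound. -/

section FiniteProbability

variable {Ω ι : Type*} [Fintype Ω]

open Classical in
/-- The probability of `P` for a uniformly random element of a finite type. -/
noncomputable def uniformProb (P : Ω → Prop) : ℝ := 𝔼 ω, if P ω then (1 : ℝ) else 0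

lemma uniformProb_eq_card_div (P : Ω → Prop) :
    uniformProb P = (Nat.card {ω // P ω} : ℝ) / Nat.card Ω := by
  classical
  rw [uniformProb, Fintype.expect_eq_sum_div_card, Finset.sum_boole, Nat.card_eq_fintype_card,
    Nat.card_eq_fintype_card, Fintype.card_subtype]

lemma uniformProb_mono {P P' : Ω → Prop} (h : ∀ ω, P ω → P' ω) :
    uniformProb P ≤ uniformProb P' := by
  classical
  refine Finset.expect_le_expect fun ω _ => ?_
  by_cases hP : P ω
  · simp [hP, h ω hP]
  · simp only [hP, if_false]; split_ifs <;> norm_num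

lemma uniformProb_false : uniformProb (fun _ : Ω => False) = 0 := by
  simp [uniformProb]

lemma uniformProb_not [Nonempty Ω] (P : Ω → Prop) :
    uniformProb (fun ω => ¬ P ω) = 1 - uniformProb P := by
  classical
  rw [uniformProb, uniformProb, ← Fintype.expect_one (ι := Ω) (M := ℝ),
    ← Finset.expect_sub_distrib]
  refine Finset.expect_congr rfl fun ω _ => ?_
  by_cases h : P ω <;> simp [h]

lemma uniformProb_or_le (P P' : Ω → Prop) :
    uniformProb (fun ω => P ω ∨ P' ω) ≤ uniformProb P + uniformProb P' := by
  classical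
  rw [uniformProb, uniformProb, uniformProb, ← Finset.expect_add_distrib]
  refine Finset.expect_le_expect fun ω _ => ?_
  by_cases h : P ω <;> by_cases h' : P' ω <;> simp [h, h']

lemma uniformProb_exists_mem_le (s : Finset ι) (P : ι → Ω → Prop) :
    uniformProb (fun ω => ∃ i ∈ s, P i ω) ≤ ∑ i ∈ s, uniformProb (P i) := by
  classical
  induction s using Finset.induction_on with
  | empty => simp [uniformProb_false]
  | insert i s hi ih =>
    rw [Finset.sum_insert hi]
    refine le_trans ?_ ((uniformProb_or_le (P i) (fun ω => ∃ i ∈ s, P i ω)).trans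
      (by gcongr))
    exact uniformProb_mono fun ω => by simp

lemma uniformProb_exists_le [Fintype ι] (P : ι → Ω → Prop) {δ : ℝ}
    (h : ∀ i, uniformProb (P i) ≤ δ) :
    uniformProb (fun ω => ∃ i, P i ω) ≤ Fintype.card ι * δ := by
  refine (uniformProb_mono fun ω => ?_).trans
    ((uniformProb_exists_mem_le Finset.univ P).trans ((Finset.sum_le_sum fun i _ => h i).trans ?_))
  · simp
  · simp [Finset.card_univ]

/-- Markov's inequality. -/
lemma uniformProb_le_expect_div {f : Ω → ℝ} (hf : ∀ ω, 0 ≤ f ω) {a : ℝ} (ha : 0 < a)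
    (P : Ω → Prop) (hP : ∀ ω, P ω → a ≤ f ω) : uniformProb P ≤ (𝔼 ω, f ω) / a := by
  classical
  rw [uniformProb, Finset.expect_div]
  refine Finset.expect_le_expect fun ω _ => ?_
  split_ifs with h
  · rw [le_div_iff₀ ha, one_mul]; exact hP ω h
  · exact div_nonneg (hf ω) ha.le

lemma exists_not_of_uniformProb_lt_one [Nonempty Ω] {P : Ω → Prop} (h : uniformProb P < 1) :
    ∃ ω, ¬ P ω := by
  by_contra! hP
  apply h.ne
  simp [uniformProb, hP]

lemma expect_prod_type {Ω' : Type*} [Fintype Ω'] (f : Ω → Ω' → ℝ) :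
    𝔼 x : Ω × Ω', f x.1 x.2 = 𝔼 a, 𝔼 b, f a b := by
  rw [← Finset.univ_product_univ, Finset.expect_product]

lemma uniformProb_prod_le {Ω' : Type*} [Fintype Ω'] [Nonempty Ω] (P : Ω × Ω' → Prop) {δ : ℝ}
    (h : ∀ a, uniformProb (fun b => P (a, b)) ≤ δ) : uniformProb P ≤ δ := by
  classical
  have := expect_prod_type (fun (a : Ω) (b : Ω') => if P (a, b) then (1 : ℝ) else 0)
  rw [uniformProb]
  simp only [Prod.mk.eta] at this
  rw [this]
  exact (Finset.expect_le_expect fun a _ => h a).trans_eq (Fintype.expect_const δ)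

lemma uniformProb_fst {Ω' : Type*} [Fintype Ω'] [Nonempty Ω'] (P : Ω → Prop) :
    uniformProb (fun x : Ω × Ω' => P x.1) = uniformProb P := by
  classical
  rw [uniformProb, uniformProb,
    expect_prod_type (fun (a : Ω) (_ : Ω') => if P a then (1 : ℝ) else 0)]
  simp

section Pi

variable [Fintype ι] [DecidableEq ι]

/-- Independence of the coordinates; the later computations with independent choices reduce to this
product formula. -/
lemma expect_pi_prod (g : ι → Ω → ℝ) :
    𝔼 ω : ι → Ω, ∏ i, g i (ω i) = ∏ i, 𝔼 a, g i a := by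
  simp only [Fintype.expect_eq_sum_div_card, Finset.prod_div_distrib]
  rw [Finset.prod_univ_sum, Fintype.piFinset_univ]
  simp

variable [Nonempty Ω]

lemma expect_pi_eval (g : Ω → ℝ) (i : ι) : 𝔼 ω : ι → Ω, g (ω i) = 𝔼 a, g a := by
  have := expect_pi_prod (fun j a => if j = i then g a else 1)
  simp only [Finset.prod_ite_eq', Finset.mem_univ, if_true] at this
  rw [this, Finset.prod_eq_single i]
  · simp
  · intro j _ hj; simp [hj]
  · simp

lemma uniformProb_pi_eval (P : Ω → Prop) (i : ι) :
    uniformProb (fun ω : ι → Ω => P (ω i)) = uniformProb P := by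
  classical
  exact expect_pi_eval (fun a => if P a then (1 : ℝ) else 0) i

lemma expect_pi_eval_mul_eval (g h : Ω → ℝ) {i j : ι} (hij : i ≠ j) :
    𝔼 ω : ι → Ω, g (ω i) * h (ω j) = (𝔼 a, g a) * 𝔼 a, h a := by
  have := expect_pi_prod (fun k a => (if k = i then g a else 1) * (if k = j then h a else 1))
  simp only [Finset.prod_mul_distrib, Finset.prod_ite_eq', Finset.mem_univ, if_true] at this
  rw [this, ← Finset.mul_prod_erase _ _ (Finset.mem_univ i),
    ← Finset.mul_prod_erase _ _ (Finset.mem_erase.2 ⟨hij.symm, Finset.mem_univ j⟩),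
    Finset.prod_eq_one]
  · simp [hij, hij.symm]
  · intro k hk
    simp only [Finset.mem_erase] at hk
    simp [hk.1, hk.2.1]

lemma expect_sq_sum_pi_eval (g : Ω → ℝ) (hg : 𝔼 a, g a = 0) :
    𝔼 ω : ι → Ω, (∑ i, g (ω i)) ^ 2 = Fintype.card ι * 𝔼 a, g a ^ 2 := by
  simp only [sq, Finset.sum_mul_sum, Finset.expect_sum_comm]
  rw [Finset.sum_congr rfl (g := fun _ => 𝔼 a, g a * g a)]
  · simp [Finset.card_univ]
  intro i _
  rw [Finset.sum_eq_single i]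
  · exact expect_pi_eval (fun a => g a * g a) i
  · intro j _ hj
    rw [expect_pi_eval_mul_eval g g hj.symm, hg, zero_mul]
  · simp

open Classical in
/-- A Chernoff bound: the number of coordinates in `s` that fall into their bad sets. -/
lemma uniformProb_le_card_filter_le (s : Finset ι) (B : ι → Ω → Prop) {p : ℝ} (k : ℕ)
    (hB : ∀ i ∈ s, uniformProb (B i) ≤ p) (hk : 6 * (s.card * p) ≤ k) :
    uniformProb (fun ω : ι → Ω => k ≤ (s.filter fun i => B i (ω i)).card) ≤ (1 / 2) ^ k := by
  -- Exponential moment with base 4: it factors and is at most `exp (3 * p * s.card) ≤ exp (k / 2) ≤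
  -- 2 ^ k`; Markov's inequality at `4 ^ k` then leaves `(1 / 2) ^ k`.
  have hmain : 𝔼 ω : ι → Ω, (4 : ℝ) ^ (s.filter fun i => B i (ω i)).card ≤ 2 ^ k := by
    have h1 : ∀ ω : ι → Ω, (4 : ℝ) ^ (s.filter fun i => B i (ω i)).card =
        ∏ i, (if i ∈ s then (1 + 3 * if B i (ω i) then (1 : ℝ) else 0) else 1) := by
      intro ω
      rw [← Finset.prod_filter, Finset.filter_mem_eq_inter, Finset.univ_inter,
        ← Finset.prod_const, Finset.prod_filter]
      refine Finset.prod_congr rfl fun i _ => ?_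
      split_ifs <;> norm_num
    simp only [h1]
    rw [expect_pi_prod (fun i a => if i ∈ s then (1 + 3 * if B i a then (1 : ℝ) else 0) else 1)]
    have h2 : ∀ i, 𝔼 a, (if i ∈ s then (1 + 3 * if B i a then (1 : ℝ) else 0) else 1) ≤
        if i ∈ s then Real.exp (3 * p) else 1 := by
      intro i
      split_ifs with hi
      · rw [Finset.expect_add_distrib, Fintype.expect_one, ← Finset.mul_expect]
        have := hB i hi
        rw [uniformProb] at this
        linarith [Real.add_one_le_exp (3 * p)]
      · simp
    have h0 : ∀ i, 0 ≤ 𝔼 a, (if i ∈ s then (1 + 3 * if B i a then (1 : ℝ) else 0) else 1) :=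
      fun i => Finset.expect_nonneg fun a _ => by split_ifs <;> norm_num
    refine (Finset.prod_le_prod (fun i _ => h0 i) fun i _ => h2 i).trans ?_
    rw [← Finset.prod_filter, Finset.filter_mem_eq_inter, Finset.univ_inter, Finset.prod_const,
      ← Real.exp_nat_mul]
    have h3 : Real.exp (1 / 2) ≤ 2 := by
      rw [← Real.le_log_iff_exp_le (by norm_num)]
      linarith [Real.log_two_gt_d9]
    calc Real.exp (s.card * (3 * p)) ≤ Real.exp (k * (1 / 2)) := by
          apply Real.exp_le_exp.2; linarith
      _ = Real.exp (1 / 2) ^ k := Real.exp_nat_mul _ _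
      _ ≤ 2 ^ k := pow_le_pow_left₀ (Real.exp_pos _).le h3 k
  refine (uniformProb_le_expect_div (f := fun ω : ι → Ω =>
    (4 : ℝ) ^ (s.filter fun i => B i (ω i)).card) (fun ω => by positivity)
    (a := 4 ^ k) (by positivity) _ fun ω h => pow_le_pow_right₀ (by norm_num) h).trans ?_
  rw [div_le_iff₀ (by positivity), ← mul_pow]
  norm_num
  exact hmain

open Classical in
/-- If a uniformly random `ω` is bad with small probability for each of finitely many `x`, then
there is one family of `ω`s of which few are bad, whatever `x` is. -/
lemma exists_sample_card_bad_lt {X κ : Type*} [Fintype X] [Fintype κ] (B : X → Ω → Prop)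
    {p : ℝ} (k : ℕ) (hB : ∀ x, uniformProb (B x) ≤ p) (hk : 6 * (Fintype.card κ * p) ≤ k)
    (hX : Fintype.card X < 2 ^ k) :
    ∃ r : κ → Ω, ∀ x, (Finset.univ.filter fun i => B x (r i)).card < k := by
  have h : uniformProb (fun r : κ → Ω =>
      ∃ x, k ≤ (Finset.univ.filter fun i => B x (r i)).card) < 1 := by
    refine (uniformProb_exists_le _ fun x =>
      uniformProb_le_card_filter_le Finset.univ (fun _ => B x) k (fun _ _ => hB x) hk).trans_lt ?_
    rw [one_div, inv_pow, ← div_eq_mul_inv, div_lt_one (by positivity)]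
    exact_mod_cast hX
  obtain ⟨r, hr⟩ := exists_not_of_uniformProb_lt_one h
  exact ⟨r, fun x => by simpa using fun h => hr ⟨x, h⟩⟩

end Pi

end FiniteProbability

/-! ### Random vertex subsets: induced edges and surviving triangles. -/

section RandomVertexSubset

variable {V : Type*} [Fintype V] [DecidableEq V] {Q : ℕ} [NeZero Q]

/-- The vertices of colour `0`: every vertex belongs to it with probability `1 / Q`. -/
def zeroClass (φ : V → Fin Q) : Finset V := Finset.univ.filter fun v => φ v = 0

lemma expect_subset_zeroClass (U : Finset V) :
    𝔼 φ : V → Fin Q, (if U ⊆ zeroClass φ then (1 : ℝ) else 0) = (1 / (Q : ℝ)) ^ U.card := by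
  have h : ∀ φ : V → Fin Q, (if U ⊆ zeroClass φ then (1 : ℝ) else 0) =
      ∏ v, if v ∈ U then (if φ v = 0 then (1 : ℝ) else 0) else 1 := by
    intro φ
    rw [← Finset.prod_filter, Finset.filter_mem_eq_inter, Finset.univ_inter, Finset.prod_boole]
    simp [zeroClass, Finset.subset_iff]
  simp only [h]
  rw [expect_pi_prod (fun v a => if v ∈ U then (if a = (0 : Fin Q) then (1 : ℝ) else 0) else 1),
    ← Finset.prod_const]
  have hU : ∏ _v ∈ U, 1 / (Q : ℝ) = ∏ v, if v ∈ U then 1 / (Q : ℝ) else 1 := by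
    rw [← Finset.prod_filter, Finset.filter_mem_eq_inter, Finset.univ_inter]
  rw [hU]
  refine Finset.prod_congr rfl fun v _ => ?_
  split_ifs
  · rw [Fintype.expect_eq_sum_div_card]; simp
  · simp

/-- The edges with both end points in `A`. -/
def inducedEdges (E : Finset (Sym2 V)) (A : Finset V) : Finset (Sym2 V) :=
  E.filter fun e => e.toFinset ⊆ A

/-- Given that `U` has been selected, this sum is the expected number of induced edges. The three
terms account for edges with no, one and two end points in `U`. -/
lemma sum_pow_card_sdiff_le (E : Finset (Sym2 V)) (hE : ∀ e ∈ E, ¬ e.IsDiag) (U : Finset V)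
    {p : ℝ} (hp : 0 ≤ p) (hp1 : p ≤ 1) :
    ∑ e ∈ E, p ^ (e.toFinset \ U).card ≤
      p ^ 2 * E.card + p * (U.card * Fintype.card V) + (U.card : ℝ) ^ 2 := by
  set A := (U ×ˢ (Finset.univ : Finset V)).image fun x => s(x.1, x.2)
  set B := (U ×ˢ U).image fun x => s(x.1, x.2)
  have hA : (A.card : ℝ) ≤ U.card * Fintype.card V := by
    have : A.card ≤ _ := Finset.card_image_le
    rw [Finset.card_product, Finset.card_univ] at this
    exact_mod_cast this
  have hB : (B.card : ℝ) ≤ (U.card : ℝ) ^ 2 := by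
    have : B.card ≤ _ := Finset.card_image_le
    rw [Finset.card_product, ← sq] at this
    exact_mod_cast this
  have key : ∀ e ∈ E, p ^ (e.toFinset \ U).card ≤
      p ^ 2 + (if e ∈ A then p else 0) + if e ∈ B then 1 else 0 := by
    intro e he
    have hnd := hE e he
    induction e using Sym2.ind with
    | _ u v =>
    have huv : u ≠ v := by simpa using hnd
    have h0 : (0 : ℝ) ≤ if s(u, v) ∈ A then p else 0 := by split_ifs <;> simp [hp]
    have h1 : (0 : ℝ) ≤ if s(u, v) ∈ B then (1 : ℝ) else 0 := by split_ifs <;> simp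
    have h2 : 0 ≤ p ^ 2 := by positivity
    have hset : (s(u, v) : Sym2 V).toFinset = {u, v} := by ext; simp [Sym2.mem_toFinset]
    by_cases hu : u ∈ U
    · have hmA : s(u, v) ∈ A := Finset.mem_image.2 ⟨(u, v), by simp [hu], rfl⟩
      by_cases hv : v ∈ U
      · have hmB : s(u, v) ∈ B := Finset.mem_image.2 ⟨(u, v), by simp [hu, hv], rfl⟩
        have : p ^ ((s(u, v) : Sym2 V).toFinset \ U).card ≤ 1 := pow_le_one₀ hp hp1
        rw [if_pos hmB]; linarith
      · have : (s(u, v) : Sym2 V).toFinset \ U = {v} := by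
          rw [hset]; ext x; simp only [Finset.mem_sdiff, Finset.mem_insert, Finset.mem_singleton]
          grind
        rw [this, Finset.card_singleton, pow_one, if_pos hmA]; linarith
    · by_cases hv : v ∈ U
      · have hmA : s(u, v) ∈ A := Finset.mem_image.2 ⟨(v, u), by simp [hv], Sym2.eq_swap⟩
        have : (s(u, v) : Sym2 V).toFinset \ U = {u} := by
          rw [hset]; ext x; simp only [Finset.mem_sdiff, Finset.mem_insert, Finset.mem_singleton]
          grind
        rw [this, Finset.card_singleton, pow_one, if_pos hmA]; linarith
      · have : (s(u, v) : Sym2 V).toFinset \ U = {u, v} := by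
          rw [hset]; ext x; simp only [Finset.mem_sdiff, Finset.mem_insert, Finset.mem_singleton]
          grind
        rw [this, Finset.card_pair huv]; linarith
  refine (Finset.sum_le_sum key).trans ?_
  rw [Finset.sum_add_distrib, Finset.sum_add_distrib, Finset.sum_const, nsmul_eq_mul,
    ← Finset.sum_filter, ← Finset.sum_filter, Finset.sum_const, Finset.sum_const, nsmul_eq_mul,
    nsmul_eq_mul, mul_one]
  have hA' : ((E.filter (· ∈ A)).card : ℝ) ≤ U.card * Fintype.card V :=
    le_trans (by exact_mod_cast Finset.card_le_card fun x hx => (Finset.mem_filter.1 hx).2) hA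
  have hB' : ((E.filter (· ∈ B)).card : ℝ) ≤ (U.card : ℝ) ^ 2 :=
    le_trans (by exact_mod_cast Finset.card_le_card fun x hx => (Finset.mem_filter.1 hx).2) hB
  nlinarith

/-- Induction on the moment: one factor of the power is expanded as a sum over edges `e`, and `e` is
absorbed into the conditioning set `U`. Each step adds at most two vertices to `U`, so `K` bounds
its size throughout. -/
lemma expect_card_inducedEdges_pow_le (E : Finset (Sym2 V)) (hE : ∀ e ∈ E, ¬ e.IsDiag) (K k : ℕ)
    (U : Finset V) (hU : U.card + 2 * k ≤ K) :
    𝔼 φ : V → Fin Q, (if U ⊆ zeroClass φ then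
        ((inducedEdges E (zeroClass φ)).card : ℝ) ^ k else 0) ≤
      (1 / (Q : ℝ)) ^ U.card *
        ((1 / (Q : ℝ)) ^ 2 * E.card + 1 / (Q : ℝ) * (K * Fintype.card V) + (K : ℝ) ^ 2) ^ k := by
  have hQ : (1 : ℝ) ≤ Q := by exact_mod_cast NeZero.one_le
  have hp : 0 ≤ 1 / (Q : ℝ) := by positivity
  have hp1 : 1 / (Q : ℝ) ≤ 1 := by rw [div_le_one (by linarith)]; exact hQ
  set p := 1 / (Q : ℝ) with hpdef
  set b := p ^ 2 * E.card + p * (K * Fintype.card V) + (K : ℝ) ^ 2 with hb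
  have hb0 : 0 ≤ b := by positivity
  induction k generalizing U with
  | zero => simp [hpdef, expect_subset_zeroClass U]
  | succ k ih =>
    have hsplit : ∀ φ : V → Fin Q, (if U ⊆ zeroClass φ then
        ((inducedEdges E (zeroClass φ)).card : ℝ) ^ (k + 1) else 0) =
        ∑ e ∈ E, if U ∪ e.toFinset ⊆ zeroClass φ then
          ((inducedEdges E (zeroClass φ)).card : ℝ) ^ k else 0 := by
      intro φ
      rw [← Finset.sum_filter]
      by_cases h : U ⊆ zeroClass φ
      · rw [if_pos h]
        have : E.filter (fun e => U ∪ e.toFinset ⊆ zeroClass φ) =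
            inducedEdges E (zeroClass φ) := by
          ext e; simp [inducedEdges, Finset.union_subset_iff, h]
        rw [this, Finset.sum_const, nsmul_eq_mul, pow_succ']
      · rw [if_neg h, Finset.filter_false_of_mem, Finset.sum_empty]
        intro e _ h'
        exact h (Finset.union_subset_left h')
    simp only [hsplit, Finset.expect_sum_comm]
    have hcard : ∀ e : Sym2 V, e.toFinset.card ≤ 2 := by
      intro e
      induction e using Sym2.ind with
      | _ u v =>
      have hset : (s(u, v) : Sym2 V).toFinset = {u, v} := by ext; simp [Sym2.mem_toFinset]
      rw [hset]; exact Finset.card_le_two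
    calc _ ≤ ∑ e ∈ E, p ^ (U ∪ e.toFinset).card * b ^ k := by
          refine Finset.sum_le_sum fun e _ => ih _ ?_
          have := Finset.card_union_le U e.toFinset
          have := hcard e
          omega
      _ = p ^ U.card * b ^ k * ∑ e ∈ E, p ^ (e.toFinset \ U).card := by
          rw [Finset.mul_sum]
          refine Finset.sum_congr rfl fun e _ => ?_
          have : (U ∪ e.toFinset).card = U.card + (e.toFinset \ U).card := by
            rw [Finset.union_comm, ← Finset.card_sdiff_add_card e.toFinset U, add_comm]
          rw [this, pow_add]; ring
      _ ≤ p ^ U.card * b ^ k * b := by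
          refine mul_le_mul_of_nonneg_left ?_ (by positivity)
          refine (sum_pow_card_sdiff_le E hE U hp hp1).trans ?_
          have hUK : (U.card : ℝ) ≤ K := by exact_mod_cast (by omega : U.card ≤ K)
          rw [hb]
          gcongr
      _ = _ := by ring

/-- A tail bound for the number of edges induced by a random vertex subset. -/
lemma uniformProb_lt_card_inducedEdges_le (E : Finset (Sym2 V)) (hE : ∀ e ∈ E, ¬ e.IsDiag)
    (k : ℕ) {z : ℝ} (hz : 0 < z)
    (h : 2 * ((1 / (Q : ℝ)) ^ 2 * E.card + 1 / (Q : ℝ) * ((2 * k : ℕ) * Fintype.card V) +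
      ((2 * k : ℕ) : ℝ) ^ 2) ≤ z) :
    uniformProb (fun φ : V → Fin Q => z < (inducedEdges E (zeroClass φ)).card) ≤
      (1 / 2) ^ k := by
  have hm := expect_card_inducedEdges_pow_le (Q := Q) E hE (2 * k) k ∅ (by simp)
  simp only [Finset.empty_subset, if_true, Finset.card_empty, pow_zero, one_mul] at hm
  refine (uniformProb_le_expect_div (f := fun φ : V → Fin Q =>
    ((inducedEdges E (zeroClass φ)).card : ℝ) ^ k) (fun φ => by positivity)
    (a := z ^ k) (by positivity) _ fun φ hφ => pow_le_pow_left₀ hz.le hφ.le k).trans ?_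
  rw [div_le_iff₀ (by positivity), ← mul_pow]
  refine hm.trans (pow_le_pow_left₀ (by positivity) (by linarith) k)

/-- The members of `T` contained in `A`. -/
def membersWithin (T : Finset (Finset V)) (A : Finset V) : Finset (Finset V) :=
  T.filter fun t => t ⊆ A

lemma expect_card_membersWithin (T : Finset (Finset V)) (hT : ∀ t ∈ T, t.card = 3) :
    𝔼 φ : V → Fin Q, ((membersWithin T (zeroClass φ)).card : ℝ) =
      T.card * (1 / (Q : ℝ)) ^ 3 := by
  have h : ∀ φ : V → Fin Q, ((membersWithin T (zeroClass φ)).card : ℝ) =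
      ∑ t ∈ T, if t ⊆ zeroClass φ then (1 : ℝ) else 0 := fun φ => by
    rw [Finset.sum_boole]; rfl
  simp only [h, Finset.expect_sum_comm, expect_subset_zeroClass]
  rw [Finset.sum_congr rfl (fun t ht => by rw [hT t ht]), Finset.sum_const, nsmul_eq_mul]

/-- The second moment is a sum over pairs of triples: equal ones contribute `p ^ 3`, and distinct
ones at most `p ^ 4`, since their union has at least four vertices. -/
lemma expect_sq_card_membersWithin_le (T : Finset (Finset V)) (hT : ∀ t ∈ T, t.card = 3) :
    𝔼 φ : V → Fin Q, ((membersWithin T (zeroClass φ)).card - T.card * (1 / (Q : ℝ)) ^ 3) ^ 2 ≤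
      T.card * (1 / (Q : ℝ)) ^ 3 + (T.card : ℝ) ^ 2 * (1 / (Q : ℝ)) ^ 4 := by
  have hQ : (1 : ℝ) ≤ Q := by exact_mod_cast NeZero.one_le
  have hp : 0 ≤ 1 / (Q : ℝ) := by positivity
  have hp1 : 1 / (Q : ℝ) ≤ 1 := by rw [div_le_one (by linarith)]; exact hQ
  have hmean := expect_card_membersWithin (Q := Q) T hT
  set p := 1 / (Q : ℝ) with hpdef
  have hsq : 𝔼 φ : V → Fin Q, ((membersWithin T (zeroClass φ)).card : ℝ) ^ 2 ≤
      (T.card : ℝ) ^ 2 * p ^ 6 + T.card * p ^ 3 + (T.card : ℝ) ^ 2 * p ^ 4 := by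
    have h : ∀ φ : V → Fin Q, ((membersWithin T (zeroClass φ)).card : ℝ) ^ 2 =
        ∑ t ∈ T, ∑ t' ∈ T, if t ∪ t' ⊆ zeroClass φ then (1 : ℝ) else 0 := fun φ => by
      have : ((membersWithin T (zeroClass φ)).card : ℝ) =
          ∑ t ∈ T, if t ⊆ zeroClass φ then (1 : ℝ) else 0 := by
        rw [Finset.sum_boole]; rfl
      rw [this, sq, Finset.sum_mul_sum]
      refine Finset.sum_congr rfl fun t _ => Finset.sum_congr rfl fun t' _ => ?_
      by_cases h1 : t ⊆ zeroClass φ <;> by_cases h2 : t' ⊆ zeroClass φ <;>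
        simp [Finset.union_subset_iff, h1, h2]
    simp only [h, Finset.expect_sum_comm, expect_subset_zeroClass, ← hpdef]
    have key : ∀ t ∈ T, ∀ t' ∈ T, p ^ (t ∪ t').card ≤
        p ^ 6 + (if t = t' then p ^ 3 else 0) + p ^ 4 := by
      intro t ht t' ht'
      have h6 : 0 ≤ p ^ 6 := by positivity
      have h4 : 0 ≤ p ^ 4 := by positivity
      by_cases heq : t = t'
      · subst heq
        rw [Finset.union_idempotent, hT t ht, if_pos rfl]; linarith
      · have hge : 4 ≤ (t ∪ t').card := by
          by_contra! hlt
          have h1 : t = t ∪ t' := Finset.eq_of_subset_of_card_le Finset.subset_union_left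
            (by rw [hT t ht]; omega)
          have h2 : t' = t ∪ t' := Finset.eq_of_subset_of_card_le Finset.subset_union_right
            (by rw [hT t' ht']; omega)
          exact heq (h1.trans h2.symm)
        have := pow_le_pow_of_le_one hp hp1 hge
        rw [if_neg heq]; linarith
    refine (Finset.sum_le_sum fun t ht => Finset.sum_le_sum fun t' ht' =>
      key t ht t' ht').trans_eq ?_
    simp only [Finset.sum_add_distrib, Finset.sum_const, nsmul_eq_mul, Finset.sum_ite_eq]
    rw [Finset.sum_ite_mem, Finset.inter_self, Finset.sum_const, nsmul_eq_mul]
    ring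
  have hexp : ∀ φ : V → Fin Q,
      ((membersWithin T (zeroClass φ)).card - T.card * p ^ 3) ^ 2 =
      ((membersWithin T (zeroClass φ)).card : ℝ) ^ 2 +
        (-2 * (T.card * p ^ 3)) * (membersWithin T (zeroClass φ)).card +
        (T.card * p ^ 3) ^ 2 := fun φ => by ring
  simp only [hexp, Finset.expect_add_distrib, ← Finset.mul_expect, hmean, Fintype.expect_const]
  nlinarith

/-- Chebyshev's inequality for the average, over independent random vertex subsets, of the number
of triangles within a subset. -/
lemma uniformProb_not_abs_average_sub_le {L : ℕ} (T : Finset (Finset V))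
    (hT : ∀ t ∈ T, t.card = 3) {δ : ℝ} (hδ : 0 < δ) (hTQ : Q ≤ T.card)
    (hL : 24 * (Q : ℝ) ^ 2 ≤ δ ^ 2 * L) :
    uniformProb (fun f : Fin L → V → Fin Q => ¬ |(Q : ℝ) ^ 3 / L *
        ∑ l, ((membersWithin T (zeroClass (f l))).card : ℝ) - T.card| ≤ δ * T.card) ≤ 1 / 12 := by
  have hQ : (1 : ℝ) ≤ Q := by exact_mod_cast NeZero.one_le
  have hTQ' : (Q : ℝ) ≤ T.card := by exact_mod_cast hTQ
  have hQ0 : (0 : ℝ) < Q := by linarith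
  have hT0 : (0 : ℝ) < T.card := by linarith
  have hL0 : (0 : ℝ) < L := by
    by_contra h
    have : δ ^ 2 * (L : ℝ) ≤ 0 := mul_nonpos_of_nonneg_of_nonpos (by positivity) (not_lt.1 h)
    nlinarith
  set g : (V → Fin Q) → ℝ := fun φ =>
    (membersWithin T (zeroClass φ)).card - T.card * (1 / (Q : ℝ)) ^ 3 with hg
  have hg0 : 𝔼 φ, g φ = 0 := by
    rw [hg, Finset.expect_sub_distrib, expect_card_membersWithin T hT, Fintype.expect_const,
      sub_self]
  have hvar := expect_sq_card_membersWithin_le (Q := Q) T hT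
  have hsum := expect_sq_sum_pi_eval (ι := Fin L) g hg0
  rw [Fintype.card_fin] at hsum
  have hdev : ∀ f : Fin L → V → Fin Q, (Q : ℝ) ^ 3 / L *
      ∑ l, ((membersWithin T (zeroClass (f l))).card : ℝ) - T.card =
      (Q : ℝ) ^ 3 / L * ∑ l, g (f l) := by
    intro f
    simp only [hg, Finset.sum_sub_distrib, Finset.sum_const, nsmul_eq_mul, Finset.card_univ,
      Fintype.card_fin]
    field_simp
  refine (uniformProb_le_expect_div (f := fun f : Fin L → V → Fin Q => (∑ l, g (f l)) ^ 2)
    (fun f => by positivity) (a := (δ * T.card * L / (Q : ℝ) ^ 3) ^ 2) (by positivity) _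
    fun f hf => ?_).trans ?_
  · rw [hdev, not_le, abs_mul, abs_of_pos (by positivity)] at hf
    rw [← sq_abs (∑ l, g (f l))]
    refine pow_le_pow_left₀ (by positivity) ?_ 2
    rw [div_le_iff₀ (by positivity)]
    rw [div_mul_eq_mul_div, lt_div_iff₀ hL0] at hf
    linarith
  · rw [hsum, div_le_iff₀ (by positivity)]
    refine (mul_le_mul_of_nonneg_left hvar hL0.le).trans ?_
    have e1 : (L : ℝ) * (T.card * (1 / (Q : ℝ)) ^ 3 + (T.card : ℝ) ^ 2 * (1 / (Q : ℝ)) ^ 4) =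
        L * (T.card * (Q : ℝ) ^ 3 + (T.card : ℝ) ^ 2 * (Q : ℝ) ^ 2) / (Q : ℝ) ^ 6 := by
      field_simp
    have e2 : 1 / 12 * (δ * T.card * L / (Q : ℝ) ^ 3) ^ 2 =
        L * (1 / 12 * (δ ^ 2 * L) * (T.card : ℝ) ^ 2) / (Q : ℝ) ^ 6 := by
      field_simp
    rw [e1, e2]
    gcongr
    -- Having at least `Q` triangles makes the diagonal part of the variance no larger than the
    -- rest.
    have h1 : (T.card : ℝ) * (Q : ℝ) ^ 3 ≤ (T.card : ℝ) ^ 2 * (Q : ℝ) ^ 2 := by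
      have : (T.card : ℝ) * (Q : ℝ) ^ 2 * Q ≤ (T.card : ℝ) * (Q : ℝ) ^ 2 * T.card := by gcongr
      linarith
    have h2 : 24 * (Q : ℝ) ^ 2 * (T.card : ℝ) ^ 2 ≤ δ ^ 2 * L * (T.card : ℝ) ^ 2 := by gcongr
    linarith

end RandomVertexSubset

/-! ### Edges as words, and even splitting of lists. -/

section Encoding

variable {n : ℕ}

/-- A list of edges as a list of words. -/
def wordsOf (l : List (Fin n × Fin n)) : List ℕ := l.flatMap fun p => [(p.1 : ℕ), (p.2 : ℕ)]

/-- The list of edges encoded by a list of words. -/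
def edgesOf (n : ℕ) : List ℕ → List (Fin n × Fin n)
  | a :: b :: l => if h : a < n ∧ b < n then (⟨a, h.1⟩, ⟨b, h.2⟩) :: edgesOf n l else edgesOf n l
  | _ => []

@[simp] lemma edgesOf_wordsOf (l : List (Fin n × Fin n)) : edgesOf n (wordsOf l) = l := by
  induction l with
  | nil => rfl
  | cons p l ih =>
    have : wordsOf (p :: l) = (p.1 : ℕ) :: (p.2 : ℕ) :: wordsOf l := rfl
    rw [this, edgesOf, dif_pos ⟨p.1.2, p.2.2⟩, ih]

@[simp] lemma length_wordsOf (l : List (Fin n × Fin n)) : (wordsOf l).length = 2 * l.length := by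
  induction l with
  | nil => rfl
  | cons p l ih =>
    have : wordsOf (p :: l) = (p.1 : ℕ) :: (p.2 : ℕ) :: wordsOf l := rfl
    rw [this]; simp only [List.length_cons, ih]; ring

lemma lt_of_mem_wordsOf {l : List (Fin n × Fin n)} {a : ℕ} (h : a ∈ wordsOf l) : a < n := by
  simp only [wordsOf, List.mem_flatMap, List.mem_cons, List.not_mem_nil, or_false] at h
  obtain ⟨p, _, rfl | rfl⟩ := h
  exacts [p.1.2, p.2.2]

/-- The multiset of the edges in a list. -/
def edgeMultiset (l : List (Fin n × Fin n)) : Multiset (Sym2 (Fin n)) :=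
  (l.map fun p => s(p.1, p.2) : List (Sym2 (Fin n)))

lemma card_edgeMultiset (l : List (Fin n × Fin n)) : (edgeMultiset l).card = l.length := by
  simp [edgeMultiset]

lemma edgeMultiset_flatMap_finRange {M : ℕ} (f : Fin M → List (Fin n × Fin n)) :
    edgeMultiset ((List.finRange M).flatMap f) = ∑ j, edgeMultiset (f j) := by
  have h : ∀ L : List (Fin M), edgeMultiset (L.flatMap f) =
      (L.map fun j => edgeMultiset (f j)).sum := by
    intro L
    induction L with
    | nil => rfl
    | cons a L ih =>
      rw [List.flatMap_cons, List.map_cons, List.sum_cons, ← ih]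
      simp [edgeMultiset]
  rw [h, Fin.sum_univ_def]

lemma edgeMultiset_filter (l : List (Fin n × Fin n)) (P : Sym2 (Fin n) → Prop) [DecidablePred P] :
    edgeMultiset (l.filter fun p => P s(p.1, p.2)) = (edgeMultiset l).filter P := by
  simp only [edgeMultiset, Multiset.filter_coe, List.filter_map]
  rfl

lemma sum_filter_eq_self {α : Type*} {M : ℕ} (s : Multiset α) (h : α → Fin M) :
    ∑ j, s.filter (fun a => h a = j) = s := by
  induction s using Multiset.induction_on with
  | empty => simp
  | cons a s ih =>
    have : ∀ j, (a ::ₘ s).filter (fun a => h a = j) =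
        (if h a = j then {a} else 0) + s.filter (fun a => h a = j) := by
      intro j
      rw [Multiset.filter_cons]
    simp only [this, Finset.sum_add_distrib, ih]
    simp

/-- The `i`-th of `M` consecutive pieces of a list. -/
def piece {α : Type*} (M : ℕ) (l : List α) (i : ℕ) : List α :=
  (l.drop (i * (l.length / M + 1))).take (l.length / M + 1)

lemma length_piece_le {α : Type*} (M : ℕ) (l : List α) (i : ℕ) :
    (piece M l i).length ≤ l.length / M + 1 := by
  simp [piece]

lemma sum_edgeMultiset_piece {M : ℕ} (hM : 0 < M) (l : List (Fin n × Fin n)) :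
    ∑ i : Fin M, edgeMultiset (piece M l i) = edgeMultiset l := by
  set b := l.length / M + 1 with hb
  have h : ∀ k : ℕ, ∑ i ∈ Finset.range k, edgeMultiset (piece M l i) =
      edgeMultiset (l.take (k * b)) := by
    intro k
    induction k with
    | zero => simp [edgeMultiset]
    | succ k ih =>
      rw [Finset.sum_range_succ, ih, Nat.succ_mul, List.take_add]
      simp [edgeMultiset, piece, ← hb]
  rw [Fin.sum_univ_eq_sum_range (fun i => edgeMultiset (piece M l i)), h, List.take_of_length_le]
  have := Nat.lt_mul_div_succ l.length hM
  exact this.le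

end Encoding

/-! ### Triangles of an edge set. -/

section Triangles

variable {n : ℕ}

/-- The vertex sets of the triangles formed by a set of edges. -/
def triangleSets (E : Finset (Sym2 (Fin n))) : Finset (Finset (Fin n)) :=
  (Finset.univ.powersetCard 3).filter fun t => ∀ u ∈ t, ∀ v ∈ t, u ≠ v → s(u, v) ∈ E

lemma triangleSets_edgeFinset (G : SimpleGraph (Fin n)) [DecidableRel G.Adj] :
    triangleSets G.edgeFinset = G.cliqueFinset 3 := by
  ext t
  simp only [triangleSets, Finset.mem_filter, Finset.mem_powersetCard, Finset.subset_univ,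
    true_and, SimpleGraph.mem_edgeFinset, SimpleGraph.mem_edgeSet, SimpleGraph.mem_cliqueFinset_iff,
    SimpleGraph.isNClique_iff, SimpleGraph.isClique_iff, Set.Pairwise, Finset.mem_coe]
  exact ⟨fun h => ⟨fun u hu v hv => h.2 u hu v hv, h.1⟩,
    fun h => ⟨h.2, fun _ hu _ hv => h.1 _ hu _ hv⟩⟩

lemma card_eq_three_of_mem_triangleSets {E : Finset (Sym2 (Fin n))} {t : Finset (Fin n)}
    (ht : t ∈ triangleSets E) : t.card = 3 :=
  (Finset.mem_powersetCard.1 (Finset.mem_filter.1 ht).1).2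

/-- Every vertex of a triangle lies on one of its edges, so a machine that received exactly the
edges within `A` counts exactly the triangles within `A`. -/
lemma triangleSets_inducedEdges (E : Finset (Sym2 (Fin n))) (A : Finset (Fin n)) :
    triangleSets (inducedEdges E A) = membersWithin (triangleSets E) A := by
  ext t
  simp only [triangleSets, inducedEdges, membersWithin, Finset.mem_filter, Finset.mem_powersetCard,
    Finset.subset_univ, true_and]
  have hpair : ∀ u v : Fin n, s(u, v).toFinset ⊆ A ↔ u ∈ A ∧ v ∈ A := by
    intro u v
    simp [Finset.subset_iff, Sym2.mem_toFinset]
  simp only [hpair]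
  constructor
  · rintro ⟨h3, h⟩
    refine ⟨⟨h3, fun u hu v hv huv => (h u hu v hv huv).1⟩, fun u hu => ?_⟩
    obtain ⟨v, hv, hvu⟩ := Finset.exists_mem_ne (by omega : 1 < t.card) u
    exact (h u hu v hv hvu.symm).2.1
  · rintro ⟨⟨h3, h⟩, hA⟩
    exact ⟨h3, fun u hu v hv huv => ⟨h u hu v hv huv, hA hu, hA hv⟩⟩

/-- All words sent are vertices, base-`n` digits or triangle counts; the counts determine the word
bound `n ^ 4`. -/
lemma card_triangleSets_lt (hn : 2 ≤ n) (E : Finset (Sym2 (Fin n))) :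
    (triangleSets E).card < n ^ 4 := by
  calc (triangleSets E).card ≤ (Finset.powersetCard 3 (Finset.univ : Finset (Fin n))).card :=
        Finset.card_filter_le _ _
    _ = n.choose 3 := by simp
    _ ≤ n ^ 3 := Nat.choose_le_pow n 3
    _ < n ^ 4 := Nat.pow_lt_pow_right (by omega) (by omega)

end Triangles

/-! ### The five-round protocol and the contents of the memories. -/

section Protocol

variable {n M : ℕ} [NeZero M]

/-- The edges held by a machine whose messages carry edges after a header of `d` words. -/
def gatherEdges (n d : ℕ) (mem : MPCMemory M) : List (Fin n × Fin n) :=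
  (List.finRange M).flatMap fun k => edgesOf n ((mem k).drop d)

/-- The protocol: spread the edges evenly over the machines; broadcast the seeds, of which the one
of machine `0` is decoded by `R` to vertex sets `V i` and a hash function on the edges; move every
edge to its hash value; send to machine `i` the edges within `V i`; count triangles there. In the
last two exchanges of edges, at most `q` edges are sent from a machine to another one. -/
noncomputable def triangleAlgorithm (hn : 2 ≤ n) (w q : ℕ)
    (R : ℕ → (Fin M → Finset (Fin n)) × (Sym2 (Fin n) → Fin M)) (post : (Fin M → ℕ) → ℝ) :
    MPCAlgorithm M where
  rounds := 5
  seeds := n ^ w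
  seeds_pos := Nat.pow_pos (by omega)
  step r j mem s i := match r with
    | 0 => wordsOf (piece M (edgesOf n (mem j)) i)
    -- Edges survive the round only by being sent to oneself. Every machine broadcasts a seed of
    -- exactly `w` digits, so that the edges start at a known position; only the seed of machine `0`
    -- is read, and the next round forwards it as a header.
    | 1 => Nat.digitsAppend n w s ++ if i = j then wordsOf (gatherEdges n 0 mem) else []
    | 2 => (mem 0).take w ++ wordsOf (((edgesOf n ((mem j).drop w)).filter fun p =>
        (R (Nat.ofDigits n ((mem 0).take w))).2 s(p.1, p.2) = i).take q)
    | 3 => wordsOf (((gatherEdges n w mem).filter fun p =>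
        s(p.1, p.2).toFinset ⊆ (R (Nat.ofDigits n ((mem 0).take w))).1 i).take q)
    | 4 => [(triangleSets (edgeMultiset (gatherEdges n 0 mem)).toFinset).card]
  outMachine := 0
  output mem := post fun i => (mem i).headD 0

/-- The edges at machine `i` after the first round, if `e` is the initial distribution. -/
def spreadEdges (e : Fin M → List (Fin n × Fin n)) (i : Fin M) : List (Fin n × Fin n) :=
  (List.finRange M).flatMap fun j => piece M (e j) i

/-- The edges sent from `j` to `i` in the third round. -/
def hashedEdges (q : ℕ) (h : Sym2 (Fin n) → Fin M) (e : Fin M → List (Fin n × Fin n))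
    (i j : Fin M) : List (Fin n × Fin n) :=
  ((spreadEdges e j).filter fun p => h s(p.1, p.2) = i).take q

/-- The edges sent from `j` to `i` in the fourth round. -/
def inducedMessages (q : ℕ) (r : (Fin M → Finset (Fin n)) × (Sym2 (Fin n) → Fin M))
    (e : Fin M → List (Fin n × Fin n)) (i j : Fin M) : List (Fin n × Fin n) :=
  (((List.finRange M).flatMap (hashedEdges q r.2 e j)).filter fun p =>
    s(p.1, p.2).toFinset ⊆ r.1 i).take q

variable (hn : 2 ≤ n) (w q : ℕ)
  (R : ℕ → (Fin M → Finset (Fin n)) × (Sym2 (Fin n) → Fin M)) (post : (Fin M → ℕ) → ℝ)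
  (e : Fin M → List (Fin n × Fin n))

lemma memory_succ {M : ℕ} (A : MPCAlgorithm M) (x : Fin M → MPCMemory M) (ω : A.Tape)
    (r : Fin A.rounds) (i j : Fin M) :
    A.memory x ω r.succ i j = A.step r j (A.memory x ω r.castSucc j) (ω r j) i := rfl

lemma triangleAlgorithm_memory_one (ω : (triangleAlgorithm hn w q R post).Tape) (i j : Fin M) :
    (triangleAlgorithm hn w q R post).memory (edgeInput e) ω (1 : Fin 6) i j =
      wordsOf (piece M (e j) i) := by
  refine (memory_succ (triangleAlgorithm hn w q R post) (edgeInput e) ω (0 : Fin 5) i j).trans ?_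
  change wordsOf (piece M (edgesOf n (edgeInput e j j)) i) = _
  have : edgeInput e j j = wordsOf (e j) := by simp [edgeInput, wordsOf]
  rw [this, edgesOf_wordsOf]

/-- The seed drawn by machine `j` for the second round. -/
def broadcastSeed (ω : (triangleAlgorithm hn w q R post).Tape) (j : Fin M) : Fin (n ^ w) :=
  ω (1 : Fin 5) j

lemma triangleAlgorithm_memory_two (ω : (triangleAlgorithm hn w q R post).Tape) (i j : Fin M) :
    (triangleAlgorithm hn w q R post).memory (edgeInput e) ω (2 : Fin 6) i j =
      Nat.digitsAppend n w (broadcastSeed hn w q R post ω j) ++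
        if i = j then wordsOf (spreadEdges e j) else [] := by
  refine (memory_succ (triangleAlgorithm hn w q R post) (edgeInput e) ω (1 : Fin 5) i j).trans ?_
  have : gatherEdges n 0 ((triangleAlgorithm hn w q R post).memory (edgeInput e) ω (1 : Fin 6) j) =
      spreadEdges e j := by
    simp [gatherEdges, spreadEdges, triangleAlgorithm_memory_one]
  rw [← this]
  rfl

/-- The random objects determined by the seed of machine `0`. -/
def decodedSeed (ω : (triangleAlgorithm hn w q R post).Tape) :
    (Fin M → Finset (Fin n)) × (Sym2 (Fin n) → Fin M) :=
  R (broadcastSeed hn w q R post ω 0)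

lemma digitsAppend_facts {n : ℕ} (hn : 2 ≤ n) (w : ℕ) (s : Fin (n ^ w)) :
    (Nat.digitsAppend n w s).length = w ∧ Nat.ofDigits n (Nat.digitsAppend n w s) = s ∧
      ∀ a ∈ Nat.digitsAppend n w s, a < n := by
  refine ⟨Nat.length_digitsAppend (by omega) w s.2, ?_, ?_⟩
  · rw [Nat.digitsAppend, Nat.ofDigits_append_replicate_zero, Nat.ofDigits_digits]
  · intro a ha
    rw [Nat.digitsAppend, List.mem_append, List.mem_replicate] at ha
    rcases ha with ha | ha
    · exact Nat.digits_lt_base (by omega) ha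
    · omega

lemma triangleAlgorithm_memory_three (ω : (triangleAlgorithm hn w q R post).Tape) (i j : Fin M) :
    (triangleAlgorithm hn w q R post).memory (edgeInput e) ω (3 : Fin 6) i j =
      Nat.digitsAppend n w (broadcastSeed hn w q R post ω 0) ++
        wordsOf (hashedEdges q (decodedSeed hn w q R post ω).2 e i j) := by
  refine (memory_succ (triangleAlgorithm hn w q R post) (edgeInput e) ω (2 : Fin 5) i j).trans ?_
  set mem := (triangleAlgorithm hn w q R post).memory (edgeInput e) ω (2 : Fin 6) j with hmem
  have h1 : (mem 0).take w = Nat.digitsAppend n w (broadcastSeed hn w q R post ω 0) := by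
    rw [hmem, triangleAlgorithm_memory_two]
    refine List.take_left' ?_
    exact (digitsAppend_facts hn w _).1
  have h2 : edgesOf n ((mem j).drop w) = spreadEdges e j := by
    rw [hmem, triangleAlgorithm_memory_two, List.drop_left', if_pos rfl, edgesOf_wordsOf]
    exact (digitsAppend_facts hn w _).1
  change (mem 0).take w ++ wordsOf (((edgesOf n ((mem j).drop w)).filter fun p =>
        (R (Nat.ofDigits n ((mem 0).take w))).2 s(p.1, p.2) = i).take q) = _
  rw [h1, h2, (digitsAppend_facts hn w (broadcastSeed hn w q R post ω 0)).2.1]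
  rfl

lemma triangleAlgorithm_memory_four (ω : (triangleAlgorithm hn w q R post).Tape) (i j : Fin M) :
    (triangleAlgorithm hn w q R post).memory (edgeInput e) ω (4 : Fin 6) i j =
      wordsOf (inducedMessages q (decodedSeed hn w q R post ω) e i j) := by
  refine (memory_succ (triangleAlgorithm hn w q R post) (edgeInput e) ω (3 : Fin 5) i j).trans ?_
  set mem := (triangleAlgorithm hn w q R post).memory (edgeInput e) ω (3 : Fin 6) j with hmem
  have h1 : (mem 0).take w = Nat.digitsAppend n w (broadcastSeed hn w q R post ω 0) := by
    rw [hmem, triangleAlgorithm_memory_three _ _ _ _ _ _, List.take_left']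
    exact (digitsAppend_facts hn w _).1
  have h2 : gatherEdges n w mem = (List.finRange M).flatMap
      (hashedEdges q (decodedSeed hn w q R post ω).2 e j) := by
    rw [gatherEdges]
    congr 1
    funext k
    rw [hmem, triangleAlgorithm_memory_three _ _ _ _ _ _, List.drop_left', edgesOf_wordsOf]
    exact (digitsAppend_facts hn w _).1
  change wordsOf (((gatherEdges n w mem).filter fun p =>
        s(p.1, p.2).toFinset ⊆ (R (Nat.ofDigits n ((mem 0).take w))).1 i).take q) = _
  rw [h1, h2, (digitsAppend_facts hn w (broadcastSeed hn w q R post ω 0)).2.1]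
  rfl

lemma triangleAlgorithm_memory_five (ω : (triangleAlgorithm hn w q R post).Tape) (i j : Fin M) :
    (triangleAlgorithm hn w q R post).memory (edgeInput e) ω (5 : Fin 6) i j =
      [(triangleSets (∑ k, edgeMultiset
        (inducedMessages q (decodedSeed hn w q R post ω) e j k)).toFinset).card] := by
  refine (memory_succ (triangleAlgorithm hn w q R post) (edgeInput e) ω (4 : Fin 5) i j).trans ?_
  set mem := (triangleAlgorithm hn w q R post).memory (edgeInput e) ω (4 : Fin 6) j with hmem
  have h2 : gatherEdges n 0 mem = (List.finRange M).flatMap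
      (inducedMessages q (decodedSeed hn w q R post ω) e j) := by
    rw [gatherEdges]
    congr 1
    funext k
    rw [hmem, triangleAlgorithm_memory_four _ _ _ _ _ _, List.drop_zero, edgesOf_wordsOf]
  change [(triangleSets (edgeMultiset (gatherEdges n 0 mem)).toFinset).card] = _
  rw [h2, edgeMultiset_flatMap_finRange]

lemma result_triangleAlgorithm (ω : (triangleAlgorithm hn w q R post).Tape) :
    (triangleAlgorithm hn w q R post).result (edgeInput e) ω =
      post fun i => (triangleSets (∑ k, edgeMultiset
        (inducedMessages q (decodedSeed hn w q R post ω) e i k)).toFinset).card := by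
  change post (fun i => ((triangleAlgorithm hn w q R post).memory (edgeInput e) ω (5 : Fin 6) 0
    i).headD 0) = _
  simp only [triangleAlgorithm_memory_five, List.headD_cons]

/-! ### Space bounds of the protocol. -/

lemma sum_length_div_add_one_le {m : ℕ} (he : ∑ i, (e i).length = m) :
    ∑ j, ((e j).length / M + 1) ≤ m / M + M := by
  have hM : 0 < M := NeZero.pos M
  rw [Finset.sum_add_distrib]
  simp only [Finset.sum_const, Finset.card_univ, Fintype.card_fin, smul_eq_mul, mul_one]
  gcongr
  rw [Nat.le_div_iff_mul_le hM, Finset.sum_mul, ← he]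
  exact Finset.sum_le_sum fun j _ => Nat.div_mul_le_self _ _

/-- The term `M` is the rounding loss, one edge per sender. The bound is independent of the initial
distribution, under which a machine may be full. -/
lemma length_spreadEdges_le {m : ℕ} (he : ∑ i, (e i).length = m) (i : Fin M) :
    (spreadEdges e i).length ≤ m / M + M := by
  refine le_trans ?_ (sum_length_div_add_one_le e he)
  rw [spreadEdges, List.length_flatMap, ← Fin.sum_univ_def]
  exact Finset.sum_le_sum fun j _ => length_piece_le _ _ _

/-- `hload` pays for the spread edges together with the broadcast seeds, `hsend` for the messages
truncated at `q` edges. Truncation makes the bounds hold for bad seeds too. -/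
lemma triangleAlgorithm_respectsSpace {m S : ℕ} (he : ∑ i, (e i).length = m)
    (heS : ∀ i, 2 * (e i).length ≤ S) (hload : 2 * (m / M + M) + M * w ≤ S)
    (hsend : M * (w + 2 * q) ≤ S) :
    (triangleAlgorithm hn w q R post).RespectsSpace S (n ^ 4) (edgeInput e) := by
  intro ω
  have hM : 0 < M := NeZero.pos M
  have hMS : M ≤ S := by
    have := Nat.zero_le (m / M)
    omega
  have hn4 : ∀ {a : ℕ}, a < n → a < n ^ 4 := fun {a} ha =>
    ha.trans_le (Nat.le_self_pow (by omega) n)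
  have hhash : ∀ i j, (hashedEdges q (decodedSeed hn w q R post ω).2 e i j).length ≤ q :=
    fun i j => List.length_take_le _ _
  have hind : ∀ i j, (inducedMessages q (decodedSeed hn w q R post ω) e i j).length ≤ q :=
    fun i j => List.length_take_le _ _
  have hpiece : ∀ j, ∑ i : Fin M, (piece M (e j) i).length = (e j).length := by
    intro j
    simp only [← card_edgeMultiset]
    rw [← Multiset.card_sum, sum_edgeMultiset_piece hM]
  have hsum : ∀ f : Fin M → ℕ, (∀ i, f i ≤ w + 2 * q) → ∑ i, f i ≤ S := fun f hf =>
    (Finset.sum_le_sum fun i _ => hf i).trans (by simpa using hsend)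
  have hdig : ∀ s : Fin (n ^ w), (Nat.digitsAppend n w s).length = w :=
    fun s => (digitsAppend_facts hn w s).1
  have hspread := length_spreadEdges_le e he
  constructor
  · intro t i
    change Fin 6 at t
    fin_cases t
    · change ∑ j, (edgeInput e i j).length ≤ S ∧ ∀ j, ∀ a ∈ edgeInput e i j, a < n ^ 4
      constructor
      · rw [Finset.sum_eq_single i]
        · have : edgeInput e i i = wordsOf (e i) := by simp [edgeInput, wordsOf]
          rw [this, length_wordsOf]; exact heS i
        · intro j _ hj; simp [edgeInput, hj]
        · simp
      · intro j a ha
        by_cases hj : j = i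
        · have : edgeInput e i j = wordsOf (e i) := by simp [edgeInput, wordsOf, hj]
          rw [this] at ha
          exact hn4 (lt_of_mem_wordsOf ha)
        · simp [edgeInput, hj] at ha
    · change ∑ j, ((triangleAlgorithm hn w q R post).memory (edgeInput e) ω (1 : Fin 6) i j).length
        ≤ S ∧ ∀ j, ∀ a ∈ (triangleAlgorithm hn w q R post).memory (edgeInput e) ω (1 : Fin 6) i j,
          a < n ^ 4
      simp only [triangleAlgorithm_memory_one, length_wordsOf]
      refine ⟨?_, fun j a ha => hn4 (lt_of_mem_wordsOf ha)⟩
      have h1 := sum_length_div_add_one_le e he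
      have h2 := Finset.sum_le_sum fun j (_ : j ∈ Finset.univ) => length_piece_le M (e j) (i : ℕ)
      rw [← Finset.mul_sum]
      omega
    · change ∑ j, ((triangleAlgorithm hn w q R post).memory (edgeInput e) ω (2 : Fin 6) i j).length
        ≤ S ∧ ∀ j, ∀ a ∈ (triangleAlgorithm hn w q R post).memory (edgeInput e) ω (2 : Fin 6) i j,
          a < n ^ 4
      simp only [triangleAlgorithm_memory_two, List.length_append]
      constructor
      · rw [Finset.sum_add_distrib]
        simp only [hdig, Finset.sum_const, Finset.card_univ, Fintype.card_fin, smul_eq_mul]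
        rw [Finset.sum_eq_single i (fun j _ hj => by simp [hj.symm]) (by simp), if_pos rfl,
          length_wordsOf]
        have := hspread i
        omega
      · intro j a ha
        rw [List.mem_append] at ha
        rcases ha with ha | ha
        · exact hn4 ((digitsAppend_facts hn w _).2.2 a ha)
        · split_ifs at ha
          · exact hn4 (lt_of_mem_wordsOf ha)
          · simp at ha
    · change ∑ j, ((triangleAlgorithm hn w q R post).memory (edgeInput e) ω (3 : Fin 6) i j).length
        ≤ S ∧ ∀ j, ∀ a ∈ (triangleAlgorithm hn w q R post).memory (edgeInput e) ω (3 : Fin 6) i j,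
          a < n ^ 4
      simp only [triangleAlgorithm_memory_three, List.length_append, length_wordsOf, hdig]
      refine ⟨hsum _ fun j => by have := hhash i j; omega, fun j a ha => ?_⟩
      rw [List.mem_append] at ha
      rcases ha with ha | ha
      · exact hn4 ((digitsAppend_facts hn w _).2.2 a ha)
      · exact hn4 (lt_of_mem_wordsOf ha)
    · change ∑ j, ((triangleAlgorithm hn w q R post).memory (edgeInput e) ω (4 : Fin 6) i j).length
        ≤ S ∧ ∀ j, ∀ a ∈ (triangleAlgorithm hn w q R post).memory (edgeInput e) ω (4 : Fin 6) i j,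
          a < n ^ 4
      simp only [triangleAlgorithm_memory_four, length_wordsOf]
      exact ⟨hsum _ fun j => by have := hind i j; omega, fun j a ha => hn4 (lt_of_mem_wordsOf ha)⟩
    · change ∑ j, ((triangleAlgorithm hn w q R post).memory (edgeInput e) ω (5 : Fin 6) i j).length
        ≤ S ∧ ∀ j, ∀ a ∈ (triangleAlgorithm hn w q R post).memory (edgeInput e) ω (5 : Fin 6) i j,
          a < n ^ 4
      simp only [triangleAlgorithm_memory_five]
      refine ⟨by simpa using hMS, fun j a ha => ?_⟩
      rw [List.mem_singleton] at ha
      rw [ha]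
      exact card_triangleSets_lt hn _
  · intro r j
    change Fin 5 at r
    fin_cases r
    · change ∑ i, ((triangleAlgorithm hn w q R post).memory (edgeInput e) ω (1 : Fin 6) i j).length
        ≤ S
      simp only [triangleAlgorithm_memory_one, length_wordsOf]
      rw [← Finset.mul_sum, hpiece]
      exact heS j
    · change ∑ i, ((triangleAlgorithm hn w q R post).memory (edgeInput e) ω (2 : Fin 6) i j).length
        ≤ S
      simp only [triangleAlgorithm_memory_two, List.length_append]
      rw [Finset.sum_add_distrib]
      simp only [hdig, Finset.sum_const, Finset.card_univ, Fintype.card_fin, smul_eq_mul]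
      rw [Finset.sum_eq_single j (fun i _ hi => by simp [hi]) (by simp), if_pos rfl,
        length_wordsOf]
      have := hspread j
      omega
    · change ∑ i, ((triangleAlgorithm hn w q R post).memory (edgeInput e) ω (3 : Fin 6) i j).length
        ≤ S
      simp only [triangleAlgorithm_memory_three, List.length_append, length_wordsOf, hdig]
      exact hsum _ fun i => by have := hhash i j; omega
    · change ∑ i, ((triangleAlgorithm hn w q R post).memory (edgeInput e) ω (4 : Fin 6) i j).length
        ≤ S
      simp only [triangleAlgorithm_memory_four, length_wordsOf]
      exact hsum _ fun i => by have := hind i j; omega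
    · change ∑ i, ((triangleAlgorithm hn w q R post).memory (edgeInput e) ω (5 : Fin 6) i j).length
        ≤ S
      simp only [triangleAlgorithm_memory_five]
      simpa using hMS

/-! ### Correctness of the protocol when no message is truncated. -/

omit [NeZero M] in
lemma sum_length_eq_card_of_isEdgeDistribution {G : SimpleGraph (Fin n)} [DecidableRel G.Adj]
    {S : ℕ} (h : IsEdgeDistribution G S e) : ∑ i, (e i).length = G.edgeFinset.card := by
  rw [Finset.card_def, ← h.1, Multiset.card_sum]
  exact Finset.sum_congr rfl fun i _ => (card_edgeMultiset (e i)).symm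

lemma sum_edgeMultiset_spreadEdges (E : Finset (Sym2 (Fin n)))
    (h : ∑ i, edgeMultiset (e i) = E.val) : ∑ i, edgeMultiset (spreadEdges e i) = E.val := by
  simp only [spreadEdges, edgeMultiset_flatMap_finRange]
  rw [Finset.sum_comm, ← h]
  exact Finset.sum_congr rfl fun j _ => sum_edgeMultiset_piece (NeZero.pos M) (e j)

omit [NeZero M] in
lemma sum_filter_filter {α : Type*} (f : Fin M → Multiset α) (P : α → Prop) [DecidablePred P] :
    ∑ j, (f j).filter P = (∑ j, f j).filter P :=
  (map_sum (⟨⟨Multiset.filter P, Multiset.filter_zero P⟩, Multiset.filter_add P⟩ :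
    Multiset α →+ Multiset α) f Finset.univ).symm

/-- If no message is truncated, then machine `i` receives the edges within its vertex set. -/
lemma sum_edgeMultiset_inducedMessages (E : Finset (Sym2 (Fin n)))
    (h : ∑ i, edgeMultiset (e i) = E.val)
    (r : (Fin M → Finset (Fin n)) × (Sym2 (Fin n) → Fin M))
    (h1 : ∀ j i, ((edgeMultiset (spreadEdges e j)).filter fun a => r.2 a = i).card ≤ q)
    (h2 : ∀ j i, ((inducedEdges E (r.1 i)).filter fun a => r.2 a = j).card ≤ q) (i : Fin M) :
    ∑ k, edgeMultiset (inducedMessages q r e i k) = (inducedEdges E (r.1 i)).val := by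
  have hh : ∀ i j, edgeMultiset (hashedEdges q r.2 e i j) =
      (edgeMultiset (spreadEdges e j)).filter fun a => r.2 a = i := by
    intro i j
    rw [hashedEdges, List.take_of_length_le]
    · exact edgeMultiset_filter _ (fun a => r.2 a = i)
    · have := h1 j i
      rwa [← edgeMultiset_filter, card_edgeMultiset] at this
  have hg : ∀ j, edgeMultiset ((List.finRange M).flatMap (hashedEdges q r.2 e j)) =
      E.val.filter fun a => r.2 a = j := by
    intro j
    simp only [edgeMultiset_flatMap_finRange, hh]
    rw [sum_filter_filter, sum_edgeMultiset_spreadEdges e E h]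
  have hi : ∀ k, edgeMultiset (inducedMessages q r e i k) =
      ((inducedEdges E (r.1 i)).val).filter fun a => r.2 a = k := by
    intro k
    have hf := edgeMultiset_filter ((List.finRange M).flatMap (hashedEdges q r.2 e k))
      (fun a => a.toFinset ⊆ r.1 i)
    rw [hg, Multiset.filter_comm] at hf
    rw [inducedMessages, List.take_of_length_le]
    · exact hf
    · rw [← card_edgeMultiset, hf]
      exact h2 k i
  simp only [hi]
  exact sum_filter_eq_self _ _

/-- The output is computed from the numbers of triangles within the vertex sets, unless the hash
function is bad for the placement `x` of the edges after the first round. -/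
lemma exists_placement_result_triangleAlgorithm {G : SimpleGraph (Fin n)} [DecidableRel G.Adj]
    {S m : ℕ} (hm : G.edgeFinset.card = m) (he : IsEdgeDistribution G S e) :
    ∃ x : Fin M → Finset (Sym2 (Fin n)), (∀ j, (x j).card ≤ m / M + M) ∧
      ∀ ω : (triangleAlgorithm hn w q R post).Tape,
        (∀ j i, ((x j).filter fun a => (decodedSeed hn w q R post ω).2 a = i).card ≤ q) →
        (∀ j i, ((inducedEdges G.edgeFinset ((decodedSeed hn w q R post ω).1 i)).filter
          fun a => (decodedSeed hn w q R post ω).2 a = j).card ≤ q) →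
        (triangleAlgorithm hn w q R post).result (edgeInput e) ω = post fun i =>
          (membersWithin (G.cliqueFinset 3) ((decodedSeed hn w q R post ω).1 i)).card := by
  have hsum : ∑ i, edgeMultiset (e i) = G.edgeFinset.val := he.1
  have hle : ∀ j, edgeMultiset (spreadEdges e j) ≤ G.edgeFinset.val := fun j => by
    rw [← sum_edgeMultiset_spreadEdges e G.edgeFinset hsum]
    exact Finset.single_le_sum (f := fun j => edgeMultiset (spreadEdges e j))
      (fun _ _ => Multiset.zero_le _) (Finset.mem_univ j)
  -- Forgetting order and orientation leaves a family of sets of edges; there are few enough of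
  -- these for a union bound over all placements.
  refine ⟨fun j => ⟨edgeMultiset (spreadEdges e j),
    Multiset.nodup_of_le (hle j) G.edgeFinset.nodup⟩, fun j => ?_, fun ω h1 h2 => ?_⟩
  · change (edgeMultiset (spreadEdges e j)).card ≤ _
    rw [card_edgeMultiset]
    exact length_spreadEdges_le e
      ((sum_length_eq_card_of_isEdgeDistribution e he).trans hm) j
  · rw [result_triangleAlgorithm]
    congr 1
    funext i
    rw [sum_edgeMultiset_inducedMessages q e G.edgeFinset hsum (decodedSeed hn w q R post ω) h1 h2,
      Finset.val_toFinset, triangleSets_inducedEdges, triangleSets_edgeFinset]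

/-- The output probability in terms of the broadcast seed only. -/
lemma outputProb_triangleAlgorithm_ge {P : ℝ → Prop} {B : Fin (n ^ w) → Prop}
    (h : ∀ ω : (triangleAlgorithm hn w q R post).Tape, ¬ B (broadcastSeed hn w q R post ω 0) →
      P ((triangleAlgorithm hn w q R post).result (edgeInput e) ω)) :
    1 - uniformProb B ≤ (triangleAlgorithm hn w q R post).outputProb (edgeInput e) P := by
  have : Nonempty (Fin (n ^ w)) := ⟨⟨0, Nat.pow_pos (by omega)⟩⟩
  change _ ≤ (Nat.card {ω : Fin 5 → Fin M → Fin (n ^ w) //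
    P ((triangleAlgorithm hn w q R post).result (edgeInput e) ω)} : ℝ) /
      (Nat.card (Fin 5 → Fin M → Fin (n ^ w)) : ℝ)
  rw [← uniformProb_eq_card_div, ← uniformProb_not,
    ← uniformProb_pi_eval (fun s => ¬ B s) (0 : Fin M),
    ← uniformProb_pi_eval (fun s : Fin M → Fin (n ^ w) => ¬ B (s 0)) (1 : Fin 5)]
  exact uniformProb_mono fun ω => h ω

end Protocol

/-! ### Choice of the parameters. -/

section Parameters

lemma log_two_add_one_le_three_mul_log {n : ℕ} (hn : 2 ≤ n) :
    ((Nat.log 2 n + 1 : ℕ) : ℝ) ≤ 3 * Real.log n := by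
  have h1 : ((2 : ℝ) ^ Nat.log 2 n) ≤ n := by
    exact_mod_cast Nat.pow_log_le_self 2 (by omega : n ≠ 0)
  have h2 : Nat.log 2 n * Real.log 2 ≤ Real.log n := by
    rw [← Real.log_pow]
    exact Real.log_le_log (by positivity) h1
  have h3 : Real.log 2 ≤ Real.log n := Real.log_le_log (by norm_num) (by exact_mod_cast hn)
  have h4 := Real.log_two_gt_d9
  push_cast
  nlinarith [Nat.cast_nonneg (α := ℝ) (Nat.log 2 n)]

set_option maxHeartbeats 800000 in
/-- The numbers of batches (`2 * g`), of colours (`Q`) and of machines per batch (`L`). -/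
lemma exists_parameters (c : ℕ) {ε : ℝ} (hε : 0 < ε) (hε1 : ε ≤ 1) {n m S : ℕ} (hn : 2 ≤ n)
    (hm : 1 ≤ m) (hSm : S ≤ 2 * m)
    (h : 90000 * ((c : ℝ) + 10) ^ 2 * Real.log n ^ 2 * max (√m / ε) ((n : ℝ) ^ 2 / m) ≤ S) :
    ∃ g Q L : ℕ, 20 ≤ g ∧ c + 5 ≤ g ∧ 0 < Q ∧ 0 < L ∧ 4096 * n ^ (c + 4) ≤ 2 ^ g ∧
      24 * (Q : ℝ) ^ 2 ≤ (ε / 4) ^ 2 * L ∧ 64 * g * (2 * g * L) ≤ S ∧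
      ((2 * g * L : ℕ) : ℝ) * S ≤ 2002770 * ((c : ℝ) + 10) / ε ^ 2 * Real.log n ^ 2 * m ∧
      153600 * m ≤ 2 * g * L * S ∧
      2 * ((1 / (Q : ℝ)) ^ 2 * m + 1 / (Q : ℝ) * ((2 * g : ℕ) * n) + ((2 * g : ℕ) : ℝ) ^ 2) ≤
        S / 24 ∧
      (Q : ℝ) ≤ 90000 * ((c : ℝ) + 10) ^ 2 * Real.log n ^ 2 * √((m : ℝ) / S) := by
  set l := Nat.log 2 n + 1 with hl
  set Λ := Real.log n with hΛ
  have hl2 : 2 ≤ l := by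
    have : 0 < Nat.log 2 n := Nat.log_pos (by norm_num) hn
    omega
  have hnl : n ≤ 2 ^ l := (Nat.lt_pow_succ_log_self (by norm_num) n).le
  have hn0 : (0 : ℝ) < n := by exact_mod_cast (by omega : 0 < n)
  have hl2' : (2 : ℝ) ≤ l := by exact_mod_cast hl2
  have hlΛ : (l : ℝ) ≤ 3 * Λ := log_two_add_one_le_three_mul_log hn
  have hΛ0 : 0 < Λ := by linarith
  set A : ℝ := (c : ℝ) + 10 with hA
  have hA10 : 10 ≤ A := by rw [hA]; linarith [Nat.cast_nonneg (α := ℝ) c]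
  -- Since `n ≤ 2 ^ l`, this gives `2 ^ g ≥ n ^ (c + 4) * 2 ^ (6 * l)`, enough for the failure
  -- probability.
  set g := (c + 10) * l with hg
  have hgA : (g : ℝ) = A * l := by rw [hg, hA]; push_cast; ring
  have hg20 : 20 ≤ g := by
    calc 20 = 10 * 2 := rfl
      _ ≤ g := Nat.mul_le_mul (by omega) hl2
  have hg20' : (20 : ℝ) ≤ g := by exact_mod_cast hg20
  have hgc : c + 5 ≤ g := by
    calc c + 5 ≤ (c + 10) * 1 := by omega
      _ ≤ g := Nat.mul_le_mul le_rfl (by omega)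
  have hg2 : 400 ≤ (g : ℝ) ^ 2 := by nlinarith only [hg20']
  have hH : 10000 * (g : ℝ) ^ 2 ≤ 90000 * A ^ 2 * Λ ^ 2 := by
    have : (l : ℝ) ^ 2 ≤ (3 * Λ) ^ 2 := pow_le_pow_left₀ (by positivity) hlΛ 2
    have h2 := mul_le_mul_of_nonneg_left this (sq_nonneg A)
    rw [hgA, mul_pow]
    linarith
  have hm1 : (1 : ℝ) ≤ m := by exact_mod_cast hm
  have hm0 : (0 : ℝ) < m := by linarith
  set s := √(m : ℝ) with hs
  have hs2 : s ^ 2 = m := Real.sq_sqrt hm0.le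
  have hs1 : 1 ≤ s := by rw [hs]; exact Real.one_le_sqrt.2 hm1
  have ha : 10000 * (g : ℝ) ^ 2 * s ≤ S * ε := by
    have : 10000 * (g : ℝ) ^ 2 * (s / ε) ≤ S :=
      le_trans (mul_le_mul hH (le_max_left _ _) (by positivity) (by positivity)) h
    rw [← mul_div_assoc, div_le_iff₀ hε] at this
    exact this
  have hb : 10000 * (g : ℝ) ^ 2 * (n : ℝ) ^ 2 ≤ S * m := by
    have : 10000 * (g : ℝ) ^ 2 * ((n : ℝ) ^ 2 / m) ≤ S :=
      le_trans (mul_le_mul hH (le_max_right _ _) (by positivity) (by positivity)) h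
    rw [← mul_div_assoc, div_le_iff₀ hm0] at this
    exact this
  have hSg : 10000 * (g : ℝ) ^ 2 ≤ S := by
    have h1 : (S : ℝ) * ε ≤ S * 1 := by gcongr
    have h2 : 10000 * (g : ℝ) ^ 2 * 1 ≤ 10000 * (g : ℝ) ^ 2 * s := by gcongr
    linarith
  have hS0 : (0 : ℝ) < S := by linarith
  set v := √((m : ℝ) / S) with hv
  have hv2 : v ^ 2 = m / S := Real.sq_sqrt (by positivity)
  have hv2S : v ^ 2 * S = m := by rw [hv2]; field_simp
  have hvhalf : 1 / 2 ≤ v := by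
    apply Real.le_sqrt_of_sq_le
    rw [le_div_iff₀ hS0]
    have : (S : ℝ) ≤ 2 * m := by exact_mod_cast hSm
    linarith
  -- With this `Q` the induced edges number about `m / Q ^ 2 ≤ S / 225`. As `S ≤ 2 * m` gives `v ≥ 1
  -- / 2`, rounding up costs at most `2 * v`.
  set Q := ⌈15 * v⌉₊ with hQ
  have hQlo : 15 * v ≤ Q := Nat.le_ceil _
  have hQhi : (Q : ℝ) ≤ 17 * v := by
    have := (Nat.ceil_lt_add_one (by positivity : 0 ≤ 15 * v)).le
    linarith
  have hQ1 : (1 : ℝ) ≤ Q := by linarith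
  have hQSlo : 225 * (m : ℝ) ≤ (Q : ℝ) ^ 2 * S := by
    have : (15 * v) ^ 2 * S ≤ (Q : ℝ) ^ 2 * S := by gcongr
    rwa [mul_pow, mul_assoc, hv2S, show (15 : ℝ) ^ 2 = 225 by norm_num] at this
  have hQShi : (Q : ℝ) ^ 2 * S ≤ 289 * m := by
    have : (Q : ℝ) ^ 2 * S ≤ (17 * v) ^ 2 * S := by gcongr
    rwa [mul_pow (17 : ℝ), mul_assoc (17 ^ 2 : ℝ), hv2S,
      show (17 : ℝ) ^ 2 = 289 by norm_num] at this
  -- Chebyshev's inequality with `δ = ε / 4` asks for `24 * Q ^ 2 / δ ^ 2`, and `384 = 24 * 16`.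
  set L := ⌈384 * (Q : ℝ) ^ 2 / ε ^ 2⌉₊ with hL
  have hε2 : ε ^ 2 ≤ 1 := pow_le_one₀ hε.le hε1
  have hε20 : 0 < ε ^ 2 := by positivity
  have hLlo : 384 * (Q : ℝ) ^ 2 ≤ ε ^ 2 * L := by
    have := Nat.le_ceil (384 * (Q : ℝ) ^ 2 / ε ^ 2)
    rw [div_le_iff₀ hε20] at this
    linarith
  have hQ2 : 1 ≤ (Q : ℝ) ^ 2 := one_le_pow₀ hQ1
  have hLhi : ε ^ 2 * L ≤ 385 * (Q : ℝ) ^ 2 := by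
    have := (Nat.ceil_lt_add_one (by positivity : 0 ≤ 384 * (Q : ℝ) ^ 2 / ε ^ 2)).le
    rw [← hL] at this
    calc ε ^ 2 * L ≤ ε ^ 2 * (384 * (Q : ℝ) ^ 2 / ε ^ 2 + 1) := by gcongr
      _ = 384 * (Q : ℝ) ^ 2 + ε ^ 2 := by field_simp
      _ ≤ _ := by linarith
  have hLQ : 384 * (Q : ℝ) ^ 2 ≤ L := by
    have : ε ^ 2 * L ≤ 1 * L := by gcongr
    linarith
  refine ⟨g, Q, L, hg20, hgc, ?_, ?_, ?_, ?_, ?_, ?_, ?_, ?_, ?_⟩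
  · exact_mod_cast (by linarith : (0 : ℝ) < Q)
  · exact_mod_cast (by linarith : (0 : ℝ) < L)
  · have h1 : 2 ^ g = (2 ^ l) ^ (c + 4) * (2 ^ l) ^ 6 := by
      rw [← pow_add, ← pow_mul, hg]; congr 1; ring
    have h2 : 4096 ≤ (2 ^ l) ^ 6 := by
      calc 4096 = (2 ^ 2) ^ 6 := by norm_num
        _ ≤ (2 ^ l) ^ 6 := Nat.pow_le_pow_left (Nat.pow_le_pow_right (by norm_num) hl2) 6
    rw [h1, mul_comm]
    exact Nat.mul_le_mul (Nat.pow_le_pow_left hnl _) h2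
  · linarith
  -- The number of machines is of order `g * m / (S * ε ^ 2)`; the lower bound on `S` by `√m / ε`
  -- keeps it below `S / (64 * g)`.
  · have h1 : 128 * (g : ℝ) ^ 2 * L * (S * ε ^ 2) ≤ S * (S * ε ^ 2) := by
      have h2 : (10000 * (g : ℝ) ^ 2 * s) ^ 2 ≤ (S * ε) ^ 2 :=
        pow_le_pow_left₀ (by positivity) ha 2
      have h3 : 128 * (g : ℝ) ^ 2 * S * (ε ^ 2 * L) ≤ 128 * (g : ℝ) ^ 2 * S *
          (385 * (Q : ℝ) ^ 2) := by gcongr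
      have h4 : 128 * (g : ℝ) ^ 2 * 385 * ((Q : ℝ) ^ 2 * S) ≤
          128 * (g : ℝ) ^ 2 * 385 * (289 * m) := by gcongr
      have h5 : (g : ℝ) ^ 2 * m * 1 ≤ (g : ℝ) ^ 2 * m * (g : ℝ) ^ 2 := by gcongr; linarith
      have h6 : (10000 * (g : ℝ) ^ 2 * s) ^ 2 = 100000000 * ((g : ℝ) ^ 2 * m * (g : ℝ) ^ 2) := by
        rw [← hs2]; ring
      have h7 : 0 ≤ (g : ℝ) ^ 2 * m := by positivity
      linarith
    have h2 := le_of_mul_le_mul_right h1 (by positivity)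
    have h3 : ((64 * g * (2 * g * L) : ℕ) : ℝ) ≤ S := by push_cast; linarith
    exact_mod_cast h3
  · have h1 : ((2 * g * L : ℕ) : ℝ) * S * ε ^ 2 ≤ 2002770 * A * Λ ^ 2 * m := by
      have h3 : 2 * (g : ℝ) * S * (ε ^ 2 * L) ≤ 2 * (g : ℝ) * S * (385 * (Q : ℝ) ^ 2) := by gcongr
      have h4 : 2 * (g : ℝ) * 385 * ((Q : ℝ) ^ 2 * S) ≤ 2 * (g : ℝ) * 385 * (289 * m) := by gcongr
      -- A bound linear in `Λ` would hold; the square matches the common exponent `a = 2`. The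
      -- constant is `2002770 = 2 * 385 * 289 * 9`.
      have h5 : (g : ℝ) ≤ 9 * A * Λ ^ 2 := by
        have : (l : ℝ) ^ 2 ≤ (3 * Λ) ^ 2 := pow_le_pow_left₀ (by positivity) hlΛ 2
        have h6 : (l : ℝ) ≤ 9 * Λ ^ 2 := by nlinarith only [this, hl2']
        rw [hgA]
        calc A * l ≤ A * (9 * Λ ^ 2) := by gcongr
          _ = _ := by ring
      have h6 : (g : ℝ) * m ≤ 9 * A * Λ ^ 2 * m := by gcongr
      push_cast
      linarith
    rw [div_mul_eq_mul_div, div_mul_eq_mul_div, le_div_iff₀ hε20]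
    exact h1
  · have h1 : 153600 * (m : ℝ) ≤ 2 * g * L * S := by
      have h2 : 2 * (20 : ℝ) * (384 * (Q : ℝ) ^ 2) * S ≤ 2 * g * L * S := by gcongr
      linarith
    exact_mod_cast h1
  · have h1 : (1 / (Q : ℝ)) ^ 2 * m ≤ S / 225 := by
      rw [one_div, inv_pow, inv_mul_le_iff₀ (by positivity)]
      linarith
    -- The lower bound on `S` by `n ^ 2 / m` controls the edges that share one end point with the
    -- conditioning set.
    have h2 : 1500 * g * (n : ℝ) ≤ S * Q := by
      refine le_of_sq_le_sq ?_ (by positivity)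
      have h3 : 225 * m * (10000 * (g : ℝ) ^ 2 * (n : ℝ) ^ 2) ≤
          ((Q : ℝ) ^ 2 * S) * (S * m) := by gcongr
      have h4 : (1500 * g * (n : ℝ)) ^ 2 * m ≤ (S * Q : ℝ) ^ 2 * m := by linarith
      exact le_of_mul_le_mul_right h4 hm0
    have h3 : 1 / (Q : ℝ) * ((2 * g : ℕ) * n) ≤ S / 750 := by
      rw [one_div, inv_mul_le_iff₀ (by positivity)]
      push_cast
      linarith
    have h4 : ((2 * g : ℕ) : ℝ) ^ 2 ≤ S / 2500 := by push_cast; linarith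
    linarith
  · refine hQhi.trans (mul_le_mul_of_nonneg_right ?_ (by positivity))
    linarith

end Parameters

/-! ### Majority over batches and the probability of a bad choice. -/

section Sampling

variable {n Q g L q : ℕ} [NeZero Q]

/-- The vertex subset of each machine, for `K` batches of `L` machines. -/
def vertexSets {K : ℕ} (f : Fin K → Fin L → Fin n → Fin Q) (i : Fin (K * L)) : Finset (Fin n) :=
  zeroClass (f (finProdFinEquiv.symm i).1 (finProdFinEquiv.symm i).2)

/-- The estimate for the number of triangles obtained from the counts of one batch. -/
noncomputable def batchEstimate {K : ℕ} (Q : ℕ) (y : Fin (K * L) → ℕ) (k : Fin K) : ℝ :=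
  (Q : ℝ) ^ 3 / L * ∑ l, (y (finProdFinEquiv (k, l)) : ℝ)

open Classical in
/-- A value that is close to more than half of `2 * g` estimates. -/
noncomputable def majorityValue (δ : ℝ) (Y : Fin (2 * g) → ℝ) : ℝ :=
  if h : ∃ y, g < (Finset.univ.filter fun k => |Y k - y| ≤ δ * y).card then h.choose else 0

-- Two strict majorities among `2 * g` indices share an index, whose estimate is close both to the
-- chosen value and to `T`.
open Classical in
lemma abs_majorityValue_sub_le {δ : ℝ} (hδ : 0 < δ) (hδ4 : δ ≤ 1 / 4) {Y : Fin (2 * g) → ℝ}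
    {T : ℝ} (hT : (Finset.univ.filter fun k => ¬ |Y k - T| ≤ δ * T).card < g) :
    |majorityValue δ Y - T| ≤ 4 * δ * T := by
  have hT' : g < (Finset.univ.filter fun k => |Y k - T| ≤ δ * T).card := by
    have := Finset.card_filter_add_card_filter_not (s := (Finset.univ : Finset (Fin (2 * g))))
      (fun k => |Y k - T| ≤ δ * T)
    rw [Finset.card_univ, Fintype.card_fin] at this
    omega
  have hex : ∃ y, g < (Finset.univ.filter fun k => |Y k - y| ≤ δ * y).card := ⟨T, hT'⟩
  rw [majorityValue, dif_pos hex]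
  set y := hex.choose
  have hy := hex.choose_spec
  obtain ⟨k, hk⟩ : ((Finset.univ.filter fun k => |Y k - T| ≤ δ * T) ∩
      (Finset.univ.filter fun k => |Y k - y| ≤ δ * y)).Nonempty := by
    rw [← Finset.card_pos]
    have h1 := Finset.card_union_add_card_inter (Finset.univ.filter fun k => |Y k - T| ≤ δ * T)
      (Finset.univ.filter fun k => |Y k - y| ≤ δ * y)
    have h2 := Finset.card_le_univ ((Finset.univ.filter fun k => |Y k - T| ≤ δ * T) ∪
      (Finset.univ.filter fun k => |Y k - y| ≤ δ * y))
    rw [Fintype.card_fin] at h2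
    change g < (Finset.univ.filter fun k => |Y k - y| ≤ δ * y).card at hy
    omega
  simp only [Finset.mem_inter, Finset.mem_filter, Finset.mem_univ, true_and, abs_le] at hk
  obtain ⟨⟨h1, h2⟩, h3, h4⟩ := hk
  have hT0 : 0 ≤ T := by nlinarith
  have hy0 : 0 ≤ y := by nlinarith
  have hyT : y ≤ 5 / 3 * T := by nlinarith
  rw [abs_le]
  constructor <;> nlinarith

/-- The random choices are bad for the graph with edge set `E`, placed as `x`. -/
def BadChoice (g q : ℕ) (δ z : ℝ) (E : Finset (Sym2 (Fin n)))
    (x : Fin (2 * g * L) → Finset (Sym2 (Fin n)))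
    (r : (Fin (2 * g) → Fin L → Fin n → Fin Q) × (Sym2 (Fin n) → Fin (2 * g * L))) : Prop :=
  (∃ j i, q + 1 ≤ ((x j).filter fun a => r.2 a = i).card) ∨
  (∃ i, z < (inducedEdges E (vertexSets r.1 i)).card) ∨
  ((∀ i, ((inducedEdges E (vertexSets r.1 i)).card : ℝ) ≤ z) ∧
    ∃ j i, q + 1 ≤ ((inducedEdges E (vertexSets r.1 i)).filter fun a => r.2 a = j).card) ∨
  g ≤ (Finset.univ.filter fun k : Fin (2 * g) => ¬ |(Q : ℝ) ^ 3 / L *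
    ∑ l, ((membersWithin (triangleSets E) (zeroClass (r.1 k l))).card : ℝ) -
      (triangleSets E).card| ≤ δ * (triangleSets E).card).card

/-- Each hash bucket receives on average at most `z / M ≤ (q + 1) / 6` elements, so the Chernoff
bound applies to every pair. The map `d` covers both uses: the bucket is the receiver in one
exchange and the sender in the other. -/
lemma uniformProb_exists_exists_filter_le {M : ℕ} [NeZero M]
    (F : Fin M → Fin M → Finset (Sym2 (Fin n))) (d : Fin M → Fin M → Fin M) {z : ℝ}
    (hF : ∀ j i, ((F j i).card : ℝ) ≤ z) (hz : 6 * z ≤ M * (q + 1 : ℕ)) :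
    uniformProb (fun h : Sym2 (Fin n) → Fin M =>
      ∃ j i, q + 1 ≤ ((F j i).filter fun a => h a = d j i).card) ≤
      M * (M * (1 / 2) ^ (q + 1)) := by
  have hM : (0 : ℝ) < M := by exact_mod_cast NeZero.pos M
  have := uniformProb_exists_le (ι := Fin M) (fun j (h : Sym2 (Fin n) → Fin M) =>
    ∃ i, q + 1 ≤ ((F j i).filter fun a => h a = d j i).card) (δ := M * (1 / 2) ^ (q + 1))
    fun j => by
      have := uniformProb_exists_le (ι := Fin M) (fun i (h : Sym2 (Fin n) → Fin M) =>
        q + 1 ≤ ((F j i).filter fun a => h a = d j i).card) (δ := (1 / 2) ^ (q + 1)) fun i => by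
          convert uniformProb_le_card_filter_le (F j i) (fun _ (b : Fin M) => b = d j i)
            (p := 1 / M) (q + 1) (fun a _ => ?_) ?_
          · rw [uniformProb_eq_card_div]
            simp
          · have := hF j i
            rw [mul_one_div, ← mul_div_assoc, div_le_iff₀ hM]
            linarith
      simpa using this
  simpa using this

/-- Union bound over the four events; each of the two routing events costs one term per pair of
machines, the edge counts one per machine, and the majority a single term. -/
lemma uniformProb_badChoice_le [NeZero (2 * g * L)] {δ z ρ : ℝ} {E : Finset (Sym2 (Fin n))}
    {x : Fin (2 * g * L) → Finset (Sym2 (Fin n))} (hE : ∀ e ∈ E, ¬ e.IsDiag)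
    (hx : ∀ j, ((x j).card : ℝ) ≤ ρ) (hρ : 6 * ρ ≤ (2 * g * L : ℕ) * (q + 1 : ℕ)) (hz : 0 < z)
    (hzq : 6 * z ≤ (2 * g * L : ℕ) * (q + 1 : ℕ))
    (hmom : 2 * ((1 / (Q : ℝ)) ^ 2 * E.card + 1 / (Q : ℝ) * ((2 * g : ℕ) * n) +
      ((2 * g : ℕ) : ℝ) ^ 2) ≤ z)
    (hδ : 0 < δ) (hT : Q ≤ (triangleSets E).card) (hL : 24 * (Q : ℝ) ^ 2 ≤ δ ^ 2 * L)
    (hgq : g ≤ q) :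
    uniformProb (BadChoice (Q := Q) g q δ z E x) ≤
      (2 * (2 * g * L : ℕ) ^ 2 + (2 * g * L : ℕ) + 1) * (1 / 2) ^ g := by
  have hpow : (1 / 2 : ℝ) ^ (q + 1) ≤ (1 / 2) ^ g :=
    pow_le_pow_of_le_one (by norm_num) (by norm_num) (by omega)
  have h1 : uniformProb (fun r :
      (Fin (2 * g) → Fin L → Fin n → Fin Q) × (Sym2 (Fin n) → Fin (2 * g * L)) =>
      ∃ j i, q + 1 ≤ ((x j).filter fun a => r.2 a = i).card) ≤
      (2 * g * L : ℕ) * ((2 * g * L : ℕ) * (1 / 2) ^ (q + 1)) :=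
    uniformProb_prod_le _ fun f =>
      uniformProb_exists_exists_filter_le (fun j _ => x j) (fun _ i => i) (fun j _ => hx j) hρ
  have h2 : uniformProb (fun r :
      (Fin (2 * g) → Fin L → Fin n → Fin Q) × (Sym2 (Fin n) → Fin (2 * g * L)) =>
      ∃ i, z < (inducedEdges E (vertexSets r.1 i)).card) ≤ (2 * g * L : ℕ) * (1 / 2) ^ g := by
    have := uniformProb_exists_le (ι := Fin (2 * g * L)) (δ := (1 / 2) ^ g)
      (fun i (r : (Fin (2 * g) → Fin L → Fin n → Fin Q) × (Sym2 (Fin n) → Fin (2 * g * L))) =>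
        z < (inducedEdges E (vertexSets r.1 i)).card) fun i => by
      have hk : Nonempty (Fin L) := ⟨(finProdFinEquiv.symm i).2⟩
      rw [uniformProb_fst (fun f : Fin (2 * g) → Fin L → Fin n → Fin Q =>
          z < (inducedEdges E (vertexSets f i)).card)]
      have e1 := uniformProb_pi_eval (fun φ : Fin L → Fin n → Fin Q =>
        z < (inducedEdges E (zeroClass (φ (finProdFinEquiv.symm i).2))).card)
        (finProdFinEquiv.symm i).1
      have e2 := uniformProb_pi_eval (fun φ : Fin n → Fin Q =>
        z < (inducedEdges E (zeroClass φ)).card) (finProdFinEquiv.symm i).2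
      unfold vertexSets
      rw [e1, e2]
      exact uniformProb_lt_card_inducedEdges_le E hE g hz (by simpa using hmom)
    simpa using this
  have h3 : uniformProb (fun r :
      (Fin (2 * g) → Fin L → Fin n → Fin Q) × (Sym2 (Fin n) → Fin (2 * g * L)) =>
      (∀ i, ((inducedEdges E (vertexSets r.1 i)).card : ℝ) ≤ z) ∧
      ∃ j i, q + 1 ≤ ((inducedEdges E (vertexSets r.1 i)).filter fun a => r.2 a = j).card) ≤
      (2 * g * L : ℕ) * ((2 * g * L : ℕ) * (1 / 2) ^ (q + 1)) := by
    -- The hash function is independent of the vertex sets: these are fixed first, and only small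
    -- induced edge sets need to be hashed.
    refine uniformProb_prod_le _ fun f => ?_
    by_cases hf : ∀ i, ((inducedEdges E (vertexSets f i)).card : ℝ) ≤ z
    · refine (uniformProb_mono fun h hh => hh.2).trans
        (uniformProb_exists_exists_filter_le (fun _ i => inducedEdges E (vertexSets f i))
          (fun j _ => j) (fun _ i => hf i) hzq)
    · refine (uniformProb_mono (P' := fun _ => False) fun h hh => hf hh.1).trans ?_
      rw [uniformProb_false]
      positivity
  have h4 : uniformProb (fun r :
      (Fin (2 * g) → Fin L → Fin n → Fin Q) × (Sym2 (Fin n) → Fin (2 * g * L)) =>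
      g ≤ (Finset.univ.filter fun k : Fin (2 * g) => ¬ |(Q : ℝ) ^ 3 / L *
        ∑ l, ((membersWithin (triangleSets E) (zeroClass (r.1 k l))).card : ℝ) -
        (triangleSets E).card| ≤ δ * (triangleSets E).card).card) ≤ (1 / 2) ^ g := by
    rw [uniformProb_fst (fun f : Fin (2 * g) → Fin L → Fin n → Fin Q =>
      g ≤ (Finset.univ.filter fun k : Fin (2 * g) => ¬ |(Q : ℝ) ^ 3 / L *
        ∑ l, ((membersWithin (triangleSets E) (zeroClass (f k l))).card : ℝ) -
        (triangleSets E).card| ≤ δ * (triangleSets E).card).card)]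
    convert uniformProb_le_card_filter_le (Finset.univ : Finset (Fin (2 * g)))
      (fun _ (f : Fin L → Fin n → Fin Q) => ¬ |(Q : ℝ) ^ 3 / L *
        ∑ l, ((membersWithin (triangleSets E) (zeroClass (f l))).card : ℝ) -
        (triangleSets E).card| ≤ δ * (triangleSets E).card) (p := 1 / 12) g
      (fun _ _ => uniformProb_not_abs_average_sub_le (triangleSets E)
        (fun t ht => card_eq_three_of_mem_triangleSets ht) hδ hT hL) ?_
    rw [Finset.card_univ, Fintype.card_fin]
    push_cast
    linarith
  have hM0 : (0 : ℝ) ≤ (2 * g * L : ℕ) := by positivity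
  have h5 : ((2 * g * L : ℕ) : ℝ) * ((2 * g * L : ℕ) * (1 / 2) ^ (q + 1)) ≤
      (2 * g * L : ℕ) * ((2 * g * L : ℕ) * (1 / 2) ^ g) := by gcongr
  refine (uniformProb_or_le _ _).trans ?_
  have h6 := uniformProb_or_le (fun r : (Fin (2 * g) → Fin L → Fin n → Fin Q) ×
      (Sym2 (Fin n) → Fin (2 * g * L)) => ∃ i, z < (inducedEdges E (vertexSets r.1 i)).card) _ |>.trans
    (add_le_add_right ((uniformProb_or_le _ _).trans (add_le_add h3 h4)) _)
  refine (add_le_add h1 h6).trans ?_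
  linarith

end Sampling

/-! ### A fixed family of random choices, and the theorem. -/

section Main

variable {n Q g L q : ℕ} [NeZero Q]

lemma batchEstimate_vertexSets {K : ℕ} (T : Finset (Finset (Fin n)))
    (f : Fin K → Fin L → Fin n → Fin Q) (k : Fin K) :
    batchEstimate Q (fun i => (membersWithin T (vertexSets f i)).card) k =
      (Q : ℝ) ^ 3 / L * ∑ l, ((membersWithin T (zeroClass (f k l))).card : ℝ) := by
  simp [batchEstimate, vertexSets]

/-- `E` and `x` are a set of `m` edges with at least `Q` triangles and a placement of at most `ρ`
edges on each machine. -/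
def IsRelevantInput (Q m ρ : ℕ) {M : ℕ} (E : Finset (Sym2 (Fin n)))
    (x : Fin M → Finset (Sym2 (Fin n))) : Prop :=
  (∀ e ∈ E, ¬ e.IsDiag) ∧ E.card = m ∧ (∀ j, (x j).card ≤ ρ) ∧ Q ≤ (triangleSets E).card

lemma card_sym2_fin_le (hn : 1 ≤ n) : Fintype.card (Sym2 (Fin n)) ≤ n ^ 2 := by
  rw [Sym2.card, Fintype.card_fin, Nat.choose_two_right]
  refine Nat.div_le_of_le_mul ?_
  rw [Nat.add_sub_cancel]
  nlinarith

open Classical in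
/-- A family of `n ^ (c + 5)` random choices such that at most a fraction `1 / n ^ c` of them is bad
for any given input. -/
lemma exists_choices (c : ℕ) [NeZero (2 * g * L)] {δ z : ℝ} {m ρ : ℕ} (hn : 2 ≤ n)
    (hρ : 6 * (ρ : ℝ) ≤ (2 * g * L : ℕ) * (q + 1 : ℕ)) (hz : 0 < z)
    (hzq : 6 * z ≤ (2 * g * L : ℕ) * (q + 1 : ℕ))
    (hmom : 2 * ((1 / (Q : ℝ)) ^ 2 * m + 1 / (Q : ℝ) * ((2 * g : ℕ) * n) +
      ((2 * g : ℕ) : ℝ) ^ 2) ≤ z)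
    (hδ : 0 < δ) (hL : 24 * (Q : ℝ) ^ 2 ≤ δ ^ 2 * L) (hgq : g ≤ q)
    (hg : 4096 * n ^ (c + 4) ≤ 2 ^ g) (hM : 2 * g * L + 1 ≤ n ^ 2) :
    ∃ r : Fin (n ^ (c + 5)) →
        (Fin (2 * g) → Fin L → Fin n → Fin Q) × (Sym2 (Fin n) → Fin (2 * g * L)),
      ∀ E x, IsRelevantInput Q m ρ E x →
        (Finset.univ.filter fun s => BadChoice g q δ z E x (r s)).card < n ^ 5 := by
  have hn0 : (0 : ℝ) < n := by exact_mod_cast (by omega : 0 < n)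
  have hbad : ∀ X : {X : Finset (Sym2 (Fin n)) × (Fin (2 * g * L) → Finset (Sym2 (Fin n))) //
      IsRelevantInput Q m ρ X.1 X.2},
      uniformProb (BadChoice (Q := Q) g q δ z X.1.1 X.1.2) ≤ 1 / (6 * (n : ℝ) ^ c) := by
    rintro ⟨⟨E, x⟩, hE, hEm, hx, hT⟩
    refine (uniformProb_badChoice_le hE (fun j => by exact_mod_cast hx j) hρ hz hzq
      (by simp only at hEm; rw [hEm]; exact hmom) hδ hT hL hgq).trans ?_
    have h1 : ((2 * g * L : ℕ) : ℝ) + 1 ≤ (n : ℝ) ^ 2 := by exact_mod_cast hM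
    have h2 : 4096 * (n : ℝ) ^ (c + 4) ≤ 2 ^ g := by exact_mod_cast hg
    have h0 : (0 : ℝ) ≤ (2 * g * L : ℕ) := by positivity
    have h3 : 2 * ((2 * g * L : ℕ) : ℝ) ^ 2 + (2 * g * L : ℕ) + 1 ≤ 4 * (n : ℝ) ^ 4 := by
      have : (((2 * g * L : ℕ) : ℝ) + 1) ^ 2 ≤ ((n : ℝ) ^ 2) ^ 2 :=
        pow_le_pow_left₀ (by positivity) h1 2
      nlinarith
    rw [one_div_pow, mul_one_div, div_le_div_iff₀ (by positivity) (by positivity), one_mul]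
    calc _ ≤ 4 * (n : ℝ) ^ 4 * (6 * (n : ℝ) ^ c) := by gcongr
      _ = 24 * (n : ℝ) ^ (c + 4) := by ring
      _ ≤ 4096 * (n : ℝ) ^ (c + 4) := by gcongr; norm_num
      _ ≤ 2 ^ g := h2
  have hL0 : Nonempty (Fin (2 * g * L)) := ⟨0⟩
  obtain ⟨r, hr⟩ := exists_sample_card_bad_lt (κ := Fin (n ^ (c + 5)))
    (fun X : {X : Finset (Sym2 (Fin n)) × (Fin (2 * g * L) → Finset (Sym2 (Fin n))) //
      IsRelevantInput Q m ρ X.1 X.2} => BadChoice (Q := Q) g q δ z X.1.1 X.1.2) (n ^ 5) hbad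
    (by
      rw [Fintype.card_fin]
      push_cast
      refine le_of_eq ?_
      rw [pow_add]
      field_simp)
    (by
      -- An input is `2 * g * L + 1` edge sets, hence there are at most `2 ^ (n ^ 4)` inputs.
      refine (Fintype.card_subtype_le _).trans_lt ?_
      rw [Fintype.card_prod, Fintype.card_fun, Fintype.card_finset, Fintype.card_fin, ← pow_mul,
        ← pow_add]
      refine Nat.pow_lt_pow_right (by norm_num) ?_
      have h1 := card_sym2_fin_le (n := n) (by omega)
      calc _ = Fintype.card (Sym2 (Fin n)) * (2 * g * L + 1) := by ring
        _ ≤ n ^ 2 * n ^ 2 := Nat.mul_le_mul h1 hM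
        _ = n ^ 4 := by ring
        _ < n ^ 5 := Nat.pow_lt_pow_right (by omega) (by omega))
  exact ⟨r, fun E x h => hr ⟨(E, x), h⟩⟩

end Main

theorem mainTheorem1 :
    ∃ R a b : ℕ, ∀ c : ℕ, ∃ C : ℝ, 0 < C ∧ ∀ ε : ℝ, 0 < ε → ε ≤ 1 → ∃ D : ℝ, 0 < D ∧
      ∀ n m S : ℕ, 2 ≤ n → 1 ≤ m → S ≤ 2 * m →
        C * Real.log n ^ a * max (Real.sqrt m / ε) ((n : ℝ) ^ 2 / m) ≤ S →
        ∃ (M : ℕ) (A : MPCAlgorithm M),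
          A.rounds ≤ R ∧
          (M : ℝ) * S ≤ D * Real.log n ^ a * m ∧
          m ≤ M * (S / 2) ∧
          ∀ (G : SimpleGraph (Fin n)) [DecidableRel G.Adj], G.edgeFinset.card = m →
            ∀ e : Fin M → List (Fin n × Fin n), IsEdgeDistribution G S e →
              A.RespectsSpace S (n ^ b) (edgeInput e) ∧
              (C * Real.log n ^ a * Real.sqrt ((m : ℝ) / S) ≤ ((G.cliqueFinset 3).card : ℝ) →
                1 - 1 / (n : ℝ) ^ c ≤ A.outputProb (edgeInput e) (fun y =>
                  |y - ((G.cliqueFinset 3).card : ℝ)| ≤ ε * ((G.cliqueFinset 3).card : ℝ))) := by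
  classical
  refine ⟨5, 2, 4, fun c => ⟨90000 * ((c : ℝ) + 10) ^ 2, by positivity, fun ε hε hε1 =>
    ⟨2002770 * ((c : ℝ) + 10) / ε ^ 2, by positivity, fun n m S hn hm hSm hS => ?_⟩⟩⟩
  obtain ⟨g, Q, L, hg20, hgc, hQ, hL, hpow, hvar, hMSg, hspace, hmS, hmom, hQT⟩ :=
    exists_parameters c hε hε1 hn hm hSm hS
  have : NeZero Q := ⟨hQ.ne'⟩
  have hM0 : 0 < 2 * g * L := by positivity
  have : NeZero (2 * g * L) := ⟨hM0.ne'⟩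
  -- Messages of `q` edges from all machines fill at most `S / 2` words, and `q + 1` is at least six
  -- times the mean load of a pair when a set of at most `S / 24` edges is hashed.
  set q := S / (4 * (2 * g * L)) with hq
  set ρ := m / (2 * g * L) + 2 * g * L with hρ
  have hq1 : S ≤ 4 * (2 * g * L) * (q + 1) := (Nat.lt_mul_div_succ S (by positivity)).le
  have hq2 : 4 * (2 * g * L) * q ≤ S := Nat.mul_div_le S _
  have hgq : g ≤ q := by
    rw [hq, Nat.le_div_iff_mul_le (by positivity)]
    nlinarith
  have hdiv : 153600 * (m / (2 * g * L)) ≤ S := by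
    have h1 : m / (2 * g * L) * (2 * g * L) ≤ m := Nat.div_mul_le_self _ _
    refine Nat.le_of_mul_le_mul_left (?_ : 2 * g * L * _ ≤ 2 * g * L * S) hM0
    calc _ = 153600 * (m / (2 * g * L) * (2 * g * L)) := by ring
      _ ≤ 153600 * m := by omega
      _ ≤ _ := hmS
  have hMS' : 1280 * (2 * g * L) ≤ S := (Nat.mul_le_mul_right _ (by omega)).trans hMSg
  have hSq : (S : ℝ) ≤ 4 * ((2 * g * L : ℕ) * (q + 1 : ℕ)) := by
    rw [← mul_assoc]; exact_mod_cast hq1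
  have hρS : 24 * ρ ≤ S := by omega
  have hρS' : 24 * (ρ : ℝ) ≤ S := by exact_mod_cast hρS
  have hS0 : (0 : ℝ) < S := by exact_mod_cast (by omega : 0 < S)
  -- An algorithm must exist even if no graph has `m` edges. The count of inputs needs `m ≤ n ^ 2`,
  -- which bounds the number of machines; otherwise any family will do.
  obtain ⟨r, hr⟩ : ∃ r : Fin (n ^ (c + 5)) →
        (Fin (2 * g) → Fin L → Fin n → Fin Q) × (Sym2 (Fin n) → Fin (2 * g * L)),
      m ≤ n ^ 2 → ∀ E x, IsRelevantInput Q m ρ E x →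
        (Finset.univ.filter fun s => BadChoice g q (ε / 4) ((S : ℝ) / 24) E x (r s)).card <
          n ^ 5 := by
    by_cases hmn : m ≤ n ^ 2
    · obtain ⟨r, hr⟩ := exists_choices (Q := Q) (ρ := ρ) c hn (by linarith) (z := (S : ℝ) / 24)
        (by positivity) (by linarith) hmom (by positivity) hvar hgq hpow (by omega)
      exact ⟨r, fun _ => hr⟩
    · exact ⟨fun _ => (fun _ _ _ => 0, fun _ => 0), fun h => absurd h hmn⟩
  set Rnd : ℕ → (Fin (2 * g * L) → Finset (Fin n)) × (Sym2 (Fin n) → Fin (2 * g * L)) := fun s =>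
    if h : s < n ^ (c + 5) then (vertexSets (r ⟨s, h⟩).1, (r ⟨s, h⟩).2)
    else (fun _ => ∅, fun _ => 0) with hRnd
  refine ⟨2 * g * L, triangleAlgorithm hn (c + 5) q Rnd
    (fun y => majorityValue (ε / 4) (batchEstimate Q y)), le_rfl, hspace, ?_, ?_⟩
  · have h1 : S ≤ 3 * (S / 2) := by omega
    have h2 : 2 * g * L * S ≤ 2 * g * L * (3 * (S / 2)) := Nat.mul_le_mul_left _ h1
    have h3 : 2 * g * L * (3 * (S / 2)) = 3 * (2 * g * L * (S / 2)) := by ring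
    omega
  intro G _ hG e he
  constructor
  · refine triangleAlgorithm_respectsSpace hn (c + 5) q Rnd _ e
      ((sum_length_eq_card_of_isEdgeDistribution e he).trans hG) he.2 ?_ ?_
    · have h1 : 2 * g * L * (c + 5) ≤ 2 * g * L * g := Nat.mul_le_mul_left _ hgc
      have h2 : 64 * g * (2 * g * L) = 64 * (2 * g * L * g) := by ring
      omega
    · have h1 : 2 * g * L * (c + 5) ≤ 2 * g * L * g := Nat.mul_le_mul_left _ hgc
      have h2 : 64 * g * (2 * g * L) = 64 * (2 * g * L * g) := by ring
      have h3 : 2 * g * L * (c + 5 + 2 * q) = 2 * g * L * (c + 5) + 2 * (2 * g * L * q) := by ring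
      have h4 : 4 * (2 * g * L) * q = 4 * (2 * g * L * q) := by ring
      omega
  · intro hT
    have hmn : m ≤ n ^ 2 := by
      rw [← hG]
      exact (Finset.card_le_univ _).trans (card_sym2_fin_le (by omega))
    obtain ⟨x, hx, hres⟩ := exists_placement_result_triangleAlgorithm hn (c + 5) q Rnd
      (fun y => majorityValue (ε / 4) (batchEstimate Q y)) e hG he
    have hcount := hr hmn G.edgeFinset x ⟨fun a ha => G.not_isDiag_of_mem_edgeFinset ha, hG, hx, by
      rw [triangleSets_edgeFinset]
      exact_mod_cast hQT.trans hT⟩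
    refine le_trans ?_ (outputProb_triangleAlgorithm_ge hn (c + 5) q Rnd _ e
      (B := fun s => BadChoice g q (ε / 4) ((S : ℝ) / 24) G.edgeFinset x (r s)) fun ω hω => ?_)
    · have hn0 : (0 : ℝ) < n := by exact_mod_cast (by omega : 0 < n)
      refine sub_le_sub_left ?_ 1
      rw [uniformProb_eq_card_div, Nat.card_eq_fintype_card, Fintype.card_subtype,
        Nat.card_eq_fintype_card, Fintype.card_fin, div_le_div_iff₀ (by positivity) (by positivity),
        one_mul]
      calc _ ≤ (n : ℝ) ^ 5 * n ^ c := by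
            gcongr
            exact_mod_cast hcount.le
        _ = _ := by push_cast; ring
    · have hdec : decodedSeed hn (c + 5) q Rnd
          (fun y => majorityValue (ε / 4) (batchEstimate Q y)) ω =
          (vertexSets (r (broadcastSeed hn (c + 5) q Rnd _ ω 0)).1,
            (r (broadcastSeed hn (c + 5) q Rnd _ ω 0)).2) :=
        dif_pos (broadcastSeed hn (c + 5) q Rnd _ ω 0).2
      have hgood : ¬ BadChoice g q (ε / 4) ((S : ℝ) / 24) G.edgeFinset x
        (r (broadcastSeed hn (c + 5) q Rnd _ ω 0)) := hω
      generalize r (broadcastSeed hn (c + 5) q Rnd _ ω 0) = choice at hgood hdec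
      simp only [BadChoice, not_or, not_exists, not_and, not_lt, not_le] at hgood
      obtain ⟨h1, h2, h3, h4⟩ := hgood
      rw [hres ω (by rw [hdec]; exact fun j i => Nat.lt_succ_iff.1 (h1 j i))
        (by rw [hdec]; exact fun j i => Nat.lt_succ_iff.1 (h3 h2 j i)), hdec]
      have := abs_majorityValue_sub_le (g := g) (δ := ε / 4) (by positivity) (by linarith)
        (Y := batchEstimate Q fun i => (membersWithin (G.cliqueFinset 3)
          (vertexSets choice.1 i)).card) (T := (G.cliqueFinset 3).card) (by
        simp only [← triangleSets_edgeFinset, batchEstimate_vertexSets]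
        refine (Finset.card_le_card fun k hk => ?_).trans_lt h4
        simpa only [Finset.mem_filter, Finset.mem_univ, true_and, not_le] using hk)
      rwa [mul_div_cancel₀ ε (by norm_num : (4 : ℝ) ≠ 0)] at this
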